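/- All manifolds are real, smooth, Hausdorff and second countable. Let $\pi:Y\to X$ be a fibred manifold (surjective submersion) with $\dim X=n$ and fibres of dimension $m$, with fibred coordinates $(x^\lambda,y^i)$; put $\omega=dx^1\wedge\dots\wedge dx^n$. Let $$\Pi=\bigwedge^n T^*X\otimes_Y V^*Y\otimes_Y TX,\qquad \pi_{\Pi Y}:\Pi\to Y,$$ be the Legendre bundle, with canonical coordinates $(x^\lambda,y^i,p^\lambda_i)$ which transform by $$p'^\lambda_i=J\,\frac{\partial y^j}{\partial y'^i}\frac{\partial x'^\lambda}{\partial x^\mu}\,p^\mu_j,\qquad J^{-1}=\det\Big(\frac{\partial x'^\lambda}{\partial x^\mu}\Big),$$ and let $\Omega=dp^\lambda_i\wedge dy^i\wedge\omega\otimes\partial_\lambda$ be the multisymplectic form, a globally defined $(n+2)$-form on $\Pi$ with values in $TX$. A multisymplectic diffeomorphism is an isomorphism $\Phi$ of the fibred manifold $\Pi\to X$, over some diffeomorphism $f$ of $X$ (nothing is required with respect to $Y$), which preserves $\Omega$: $\Omega_{\Phi(q)}(T\Phi\, u_0,\dots,T\Phi\, u_{n+1})=Tf\,(\Omega_q(u_0,\dots,u_{n+1}))$.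 An isomorphism of $\Pi$ is a map of $\Pi$ induced (through $V^*Y$, $TX$, $T^*X$) by an isomorphism of the fibred manifold $Y\to X$. Let $n\ne1$. A diffeomorphism $\Phi$ of $\Pi$ is multisymplectic if and only if it is a composition $\Phi=\tau_r\circ G$ of an isomorphism $G$ of $\Pi$ and a translation $$\tau_r:\ q\mapsto q+r(\pi_{\Pi Y}(q)),$$ where $r=r^\lambda_i(y)\,\overline{d}y^i\wedge\omega\otimes\partial_\lambda$ is a smooth section of $\Pi\to Y$ such that, for every smooth 1-form $\phi=\phi_\lambda dx^\lambda$ on $X$, the $(n+1)$-form $r\rfloor\phi=r^\lambda_i(y)\,\phi_\lambda(x)\,\overline{d}y^i\wedge\omega$ on $Y$ is closed. This product is semidirect: $G$ and $r$ are uniquely determined by $\Phi$, and for every isomorphism $G$ and every such $r$ there is such an $r'$ with $G\circ\tau_r=\tau_{r'}\circ G$. For a smooth section $r$ of $\Pi\to Y$, the closedness condition holds if and only if $\partial_j r^\lambda_i=\partial_i r^\lambda_j$ in all fibred coordinates. -/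

import Mathlib

open scoped Manifold ContDiff

noncomputable section

namespace Multisymplectic

/-- The model space `ℝᵏ`. -/
abbrev Euc (k : ℕ) : Type := EuclideanSpace ℝ (Fin k)

/-- A fibred manifold `Y → X` with `n`-dimensional base and `m`-dimensional fibres:
a surjective smooth submersion. -/
structure FibredManifold (n m : ℕ) (X Y : Type*)
    [TopologicalSpace X] [ChartedSpace (Euc n) X]
    [TopologicalSpace Y] [ChartedSpace (Euc n × Euc m) Y] where
  proj : Y → X
  surjective : Function.Surjective proj
  submersion : Manifold.IsSubmersion 𝓘(ℝ, Euc n × Euc m) 𝓘(ℝ, Euc n) ∞ proj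

namespace FibredManifold

variable {n m : ℕ} {X Y : Type*}
  [TopologicalSpace X] [ChartedSpace (Euc n) X]
  [TopologicalSpace Y] [ChartedSpace (Euc n × Euc m) Y]

/-- Fibred coordinates `(x^λ, y^i)` on an open subset of `Y`, lying over coordinates `(x^λ)` on an
open subset of `X`. -/
structure FibredChart (π : FibredManifold n m X Y) where
  total : OpenPartialHomeomorph Y (Euc n × Euc m)
  base : OpenPartialHomeomorph X (Euc n)
  total_mem : total ∈ IsManifold.maximalAtlas 𝓘(ℝ, Euc n × Euc m) ∞ Y
  base_mem : base ∈ IsManifold.maximalAtlas 𝓘(ℝ, Euc n) ∞ X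
  proj_mem : ∀ y ∈ total.source, π.proj y ∈ base.source
  fst_total : ∀ y ∈ total.source, (total y).1 = base (π.proj y)

theorem exists_fibredChart [IsManifold 𝓘(ℝ, Euc n × Euc m) ∞ Y] (π : FibredManifold n m X Y)
    (y : Y) : ∃ κ : π.FibredChart, y ∈ κ.total.source := by
  obtain ⟨F', _, _, h⟩ := π.submersion
  have hy := h y
  let e : (Euc n × Euc m) ≃L[ℝ] (Euc n × F') := hy.equiv
  have : FiniteDimensional ℝ (Euc n × F') := e.toLinearEquiv.finiteDimensional
  have : FiniteDimensional ℝ F' :=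
    FiniteDimensional.of_surjective (LinearMap.snd ℝ (Euc n) F') LinearMap.snd_surjective
  have hdim : Module.finrank ℝ F' = Module.finrank ℝ (Euc m) := by
    have h1 := e.toLinearEquiv.finrank_eq
    simp only [Module.finrank_prod] at h1
    omega
  let e₂ : F' ≃L[ℝ] Euc m := ContinuousLinearEquiv.ofFinrankEq hdim
  let e₃ : (Euc n × Euc m) ≃L[ℝ] (Euc n × Euc m) :=
    e.trans ((ContinuousLinearEquiv.refl ℝ (Euc n)).prodCongr e₂)
  let T : OpenPartialHomeomorph Y (Euc n × Euc m) :=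
    hy.domChart.trans e₃.toHomeomorph.toOpenPartialHomeomorph
  have hT : T.source = hy.domChart.source := by simp [T]
  refine ⟨⟨T, hy.codChart, ?_, hy.codChart_mem_maximalAtlas, ?_, ?_⟩, ?_⟩
  · refine T.mem_maximalAtlas_of_contMDiffOn ?_ ?_
    · rw [hT]
      exact e₃.contDiff.contMDiff.comp_contMDiffOn
        (contMDiffOn_of_mem_maximalAtlas hy.domChart_mem_maximalAtlas)
    · refine (contMDiffOn_symm_of_mem_maximalAtlas hy.domChart_mem_maximalAtlas).comp
        (t := hy.domChart.target) (e₃.symm.contDiff.contMDiff.contMDiffOn) ?_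
      intro z hz
      simpa [T] using hz
  · intro y' hy'
    exact hy.source_subset_preimage_source (hT ▸ hy')
  · intro y' hy'
    rw [hT] at hy'
    have hz : hy.domChart y' ∈ (hy.domChart.extend 𝓘(ℝ, Euc n × Euc m)).target := by
      simpa using hy.domChart.map_source hy'
    have := hy.writtenInCharts hz
    simp [hy.domChart.left_inv hy'] at this
    simp [T, e₃, this, e]
  · rw [hT]
    exact hy.mem_domChart_source

/-- The Jacobian `∂x'^λ/∂x^μ` at `x` of a map `f : X → X`, in the coordinates `κ` at `x` and
`κ'` at `f x`. For `f = id` it is the Jacobian of a coordinate change. -/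
def baseJacobian {π : FibredManifold n m X Y} (κ κ' : π.FibredChart) (f : X → X) (x : X) :
    Euc n →L[ℝ] Euc n :=
  fderiv ℝ (κ'.base ∘ f ∘ κ.base.symm) (κ.base x)

/-- The vertical Jacobian `∂y'^i/∂y^j` at `y` of a map `g : Y → Y`, in the fibred coordinates `κ`
at `y` and `κ'` at `g y`. -/
def vertJacobian {π : FibredManifold n m X Y} (κ κ' : π.FibredChart) (g : Y → Y) (y : Y) :
    Euc m →L[ℝ] Euc m :=
  ContinuousLinearMap.snd ℝ (Euc n) (Euc m) ∘L
    fderiv ℝ (κ'.total ∘ g ∘ κ.total.symm) (κ.total y) ∘L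
      ContinuousLinearMap.inr ℝ (Euc n) (Euc m)

/-- The momentum transformation law
`p'^λ_i = J (∂y^j/∂y'^i) (∂x'^λ/∂x^μ) p^μ_j`, `J⁻¹ = det (∂x'/∂x)`, with `A = ∂x'/∂x` and
`B = ∂y/∂y'`. The momenta `p^λ_i` are the matrix entries of a linear map `ℝᵐ → ℝⁿ`. -/
def momentumTransform (A : Euc n →L[ℝ] Euc n) (B : Euc m →L[ℝ] Euc m) :
    (Euc m →L[ℝ] Euc n) →L[ℝ] (Euc m →L[ℝ] Euc n) :=
  A.det⁻¹ • (ContinuousLinearMap.compL ℝ (Euc m) (Euc n) (Euc n) A ∘L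
    (ContinuousLinearMap.compL ℝ (Euc m) (Euc m) (Euc n)).flip B)

theorem momentumTransform_apply (A : Euc n →L[ℝ] Euc n) (B : Euc m →L[ℝ] Euc m)
    (p : Euc m →L[ℝ] Euc n) : momentumTransform A B p = A.det⁻¹ • (A ∘L p ∘L B) := rfl


section Core

variable {π : FibredManifold n m X Y} {κ κ' κ'' : π.FibredChart}

theorem contDiffAt_baseTransition {x : X} (h : x ∈ κ.base.source) (h' : x ∈ κ'.base.source) :
    ContDiffAt ℝ ∞ (κ'.base ∘ id ∘ κ.base.symm) (κ.base x) := by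
  rw [← contMDiffAt_iff_contDiffAt]
  have h1 := contMDiffAt_symm_of_mem_maximalAtlas κ.base_mem (κ.base.map_source h)
  have h2 := contMDiffAt_of_mem_maximalAtlas κ'.base_mem h'
  rw [← κ.base.left_inv h] at h2
  exact h2.comp _ h1

theorem contDiffAt_totalTransition {y : Y} (h : y ∈ κ.total.source) (h' : y ∈ κ'.total.source) :
    ContDiffAt ℝ ∞ (κ'.total ∘ id ∘ κ.total.symm) (κ.total y) := by
  rw [← contMDiffAt_iff_contDiffAt]
  have h1 := contMDiffAt_symm_of_mem_maximalAtlas κ.total_mem (κ.total.map_source h)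
  have h2 := contMDiffAt_of_mem_maximalAtlas κ'.total_mem h'
  rw [← κ.total.left_inv h] at h2
  exact h2.comp _ h1

theorem baseJacobian_self {x : X} (h : x ∈ κ.base.source) :
    baseJacobian κ κ id x = ContinuousLinearMap.id ℝ (Euc n) := by
  have : κ.base ∘ id ∘ κ.base.symm =ᶠ[nhds (κ.base x)] id := by
    filter_upwards [κ.base.open_target.mem_nhds (κ.base.map_source h)] with z hz
    simp [κ.base.right_inv hz]
  rw [baseJacobian, this.fderiv_eq, fderiv_id]

theorem baseJacobian_comp {x : X} (h : x ∈ κ.base.source) (h' : x ∈ κ'.base.source)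
    (h'' : x ∈ κ''.base.source) :
    baseJacobian κ' κ'' id x ∘L baseJacobian κ κ' id x = baseJacobian κ κ'' id x := by
  have hx : (κ'.base ∘ id ∘ κ.base.symm) (κ.base x) = κ'.base x := by simp [κ.base.left_inv h]
  have h1 := (contDiffAt_baseTransition h h').differentiableAt (by simp)
  have h2 := (contDiffAt_baseTransition h' h'').differentiableAt (by simp)
  rw [← hx] at h2
  have hcomp := fderiv_comp _ h2 h1
  rw [hx] at hcomp
  rw [baseJacobian, baseJacobian, baseJacobian, ← hcomp]
  refine Filter.EventuallyEq.fderiv_eq ?_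
  have hc := κ.base.continuousAt_symm (κ.base.map_source h)
  have hm : κ'.base.source ∈ nhds (κ.base.symm (κ.base x)) := by
    rw [κ.base.left_inv h]; exact κ'.base.open_source.mem_nhds h'
  filter_upwards [hc hm] with z hz
  simp [κ'.base.left_inv hz]

theorem fderiv_totalTransition_comp {y : Y} (h : y ∈ κ.total.source) (h' : y ∈ κ'.total.source)
    (h'' : y ∈ κ''.total.source) :
    fderiv ℝ (κ''.total ∘ id ∘ κ'.total.symm) (κ'.total y) ∘L
      fderiv ℝ (κ'.total ∘ id ∘ κ.total.symm) (κ.total y) =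
    fderiv ℝ (κ''.total ∘ id ∘ κ.total.symm) (κ.total y) := by
  have hx : (κ'.total ∘ id ∘ κ.total.symm) (κ.total y) = κ'.total y := by
    simp [κ.total.left_inv h]
  have h1 := (contDiffAt_totalTransition h h').differentiableAt (by simp)
  have h2 := (contDiffAt_totalTransition h' h'').differentiableAt (by simp)
  rw [← hx] at h2
  have hcomp := fderiv_comp _ h2 h1
  rw [hx] at hcomp
  rw [← hcomp]
  refine Filter.EventuallyEq.fderiv_eq ?_
  have hc := κ.total.continuousAt_symm (κ.total.map_source h)
  have hm : κ'.total.source ∈ nhds (κ.total.symm (κ.total y)) := by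
    rw [κ.total.left_inv h]; exact κ'.total.open_source.mem_nhds h'
  filter_upwards [hc hm] with z hz
  simp [κ'.total.left_inv hz]

theorem fderiv_totalTransition_fst {y : Y} (h : y ∈ κ.total.source) (h' : y ∈ κ'.total.source)
    (v : Euc m) :
    (fderiv ℝ (κ'.total ∘ id ∘ κ.total.symm) (κ.total y) (0, v)).1 = 0 := by
  have h1 := ((contDiffAt_totalTransition h h').differentiableAt (by simp)).hasFDerivAt
  have h2 := (ContinuousLinearMap.fst ℝ (Euc n) (Euc m)).hasFDerivAt.comp _ h1
  have hb := ((contDiffAt_baseTransition (κ.proj_mem y h) (κ'.proj_mem y h')).differentiableAt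
    (by simp)).hasFDerivAt
  rw [← κ.fst_total y h] at hb
  have h3 := hb.comp (κ.total y)
    (ContinuousLinearMap.fst ℝ (Euc n) (Euc m)).hasFDerivAt
  have heq : (ContinuousLinearMap.fst ℝ (Euc n) (Euc m)) ∘ (κ'.total ∘ id ∘ κ.total.symm)
      =ᶠ[nhds (κ.total y)]
      (κ'.base ∘ id ∘ κ.base.symm) ∘ (ContinuousLinearMap.fst ℝ (Euc n) (Euc m)) := by
    have hc := κ.total.continuousAt_symm (κ.total.map_source h)
    have hm : κ'.total.source ∈ nhds (κ.total.symm (κ.total y)) := by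
      rw [κ.total.left_inv h]; exact κ'.total.open_source.mem_nhds h'
    filter_upwards [hc hm, κ.total.open_target.mem_nhds (κ.total.map_source h)] with z hz hzt
    have hs := κ.total.map_target hzt
    have e1 := κ'.fst_total _ hz
    have e2 := κ.fst_total _ hs
    rw [κ.total.right_inv hzt] at e2
    simp [e1, e2, κ.base.left_inv (κ.proj_mem _ hs)]
  have := (h3.congr_of_eventuallyEq heq).unique h2
  have := congrArg (fun T => T ((0 : Euc n), v)) this
  simpa using this.symm

theorem vertJacobian_self {y : Y} (h : y ∈ κ.total.source) :
    vertJacobian κ κ id y = ContinuousLinearMap.id ℝ (Euc m) := by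
  have : κ.total ∘ id ∘ κ.total.symm =ᶠ[nhds (κ.total y)] id := by
    filter_upwards [κ.total.open_target.mem_nhds (κ.total.map_source h)] with z hz
    simp [κ.total.right_inv hz]
  rw [vertJacobian, this.fderiv_eq, fderiv_id]
  ext v
  simp

theorem vertJacobian_comp {y : Y} (h : y ∈ κ.total.source) (h' : y ∈ κ'.total.source)
    (h'' : y ∈ κ''.total.source) :
    vertJacobian κ' κ'' id y ∘L vertJacobian κ κ' id y = vertJacobian κ κ'' id y := by
  refine ContinuousLinearMap.ext fun v => ?_
  have h0 := fderiv_totalTransition_fst h h' v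
  have h1 := congrArg (fun T => T ((0 : Euc n), v)) (fderiv_totalTransition_comp h h' h'')
  simp only [vertJacobian, ContinuousLinearMap.comp_apply, ContinuousLinearMap.inr_apply,
    ContinuousLinearMap.coe_snd'] at h1 ⊢
  rw [← h1]
  congr 2
  exact Prod.ext h0.symm rfl

theorem contDiff_det : ContDiff ℝ ∞ (fun A : Euc n →L[ℝ] Euc n => A.det) := by
  let b := (EuclideanSpace.basisFun (Fin n) ℝ).toBasis
  have : (fun A : Euc n →L[ℝ] Euc n => A.det) =
      fun A => ∑ σ : Equiv.Perm (Fin n), ((Equiv.Perm.sign σ : ℤ) : ℝ) *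
        ∏ i, (A (EuclideanSpace.single i (1 : ℝ))) (σ i) := by
    funext A
    rw [ContinuousLinearMap.det, ← LinearMap.det_toMatrix b, Matrix.det_apply']
    simp [LinearMap.toMatrix_apply, b]
  rw [this]
  refine ContDiff.sum fun σ _ => contDiff_const.mul (contDiff_prod fun i _ => ?_)
  exact ((EuclideanSpace.proj (σ i) : Euc n →L[ℝ] ℝ) ∘L
    (ContinuousLinearMap.apply ℝ (Euc n) (EuclideanSpace.single i (1 : ℝ)))).contDiff

theorem det_baseJacobian_ne_zero {x : X} (h : x ∈ κ.base.source) (h' : x ∈ κ'.base.source) :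
    (baseJacobian κ κ' id x).det ≠ 0 := by
  have := congrArg ContinuousLinearMap.det (baseJacobian_comp h h' h)
  rw [baseJacobian_self h] at this
  intro h0
  simp only [ContinuousLinearMap.det, ContinuousLinearMap.toLinearMap_comp,
    LinearMap.det_comp, ContinuousLinearMap.coe_id, LinearMap.det_id] at this h0
  rw [h0] at this
  simp at this

set_option maxSynthPendingDepth 5 in
theorem contMDiffOn_momentumTransform (κ κ' : π.FibredChart) :
    ContMDiffOn 𝓘(ℝ, Euc n × Euc m) 𝓘(ℝ, (Euc m →L[ℝ] Euc n) →L[ℝ] (Euc m →L[ℝ] Euc n)) ∞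
      (fun y => momentumTransform (baseJacobian κ κ' id (π.proj y)) (vertJacobian κ' κ id y))
      (κ.total.source ∩ κ'.total.source) := by
  rintro y ⟨h, h'⟩
  apply ContMDiffAt.contMDiffWithinAt
  have hA : ContMDiffAt 𝓘(ℝ, Euc n × Euc m) 𝓘(ℝ, Euc n →L[ℝ] Euc n) ∞
      (fun y => baseJacobian κ κ' id (π.proj y)) y := by
    have h1 := ((contDiffAt_baseTransition (κ.proj_mem y h) (κ'.proj_mem y h')).fderiv_right
      (m := ∞) (by simp)).contMDiffAt
    rw [← κ.fst_total y h] at h1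
    have h2 : ContMDiffAt 𝓘(ℝ, Euc n × Euc m) 𝓘(ℝ, Euc n) ∞ (fun y => (κ.total y).1) y :=
      contDiff_fst.contMDiff.contMDiffAt.comp y (contMDiffAt_of_mem_maximalAtlas κ.total_mem h)
    refine (h1.comp y h2).congr_of_eventuallyEq ?_
    filter_upwards [κ.total.open_source.mem_nhds h] with z hz
    simp only [baseJacobian, Function.comp_apply, κ.fst_total z hz]
  have hB : ContMDiffAt 𝓘(ℝ, Euc n × Euc m) 𝓘(ℝ, Euc m →L[ℝ] Euc m) ∞
      (fun y => vertJacobian κ' κ id y) y := by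
    have h1 := ((contDiffAt_totalTransition h' h).fderiv_right (m := ∞) (by simp))
    have h2 := (contDiffAt_const (c := ContinuousLinearMap.snd ℝ (Euc n) (Euc m))).clm_comp
      (h1.clm_comp (contDiffAt_const (c := ContinuousLinearMap.inr ℝ (Euc n) (Euc m))))
    exact h2.contMDiffAt.comp y (contMDiffAt_of_mem_maximalAtlas κ'.total_mem h')
  have hF : ContDiffAt ℝ ∞ (fun q : (Euc n →L[ℝ] Euc n) × (Euc m →L[ℝ] Euc m) =>
      momentumTransform q.1 q.2)
      (baseJacobian κ κ' id (π.proj y), vertJacobian κ' κ id y) := by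
    have h1 : ContDiffAt ℝ ∞ (fun q : (Euc n →L[ℝ] Euc n) × (Euc m →L[ℝ] Euc m) => q.1.det⁻¹)
        (baseJacobian κ κ' id (π.proj y), vertJacobian κ' κ id y) :=
      (contDiff_det.contDiffAt.comp _ contDiffAt_fst).inv
        (det_baseJacobian_ne_zero (κ.proj_mem y h) (κ'.proj_mem y h'))
    have h2 : ContDiff ℝ ∞ (fun q : (Euc n →L[ℝ] Euc n) × (Euc m →L[ℝ] Euc m) =>
        ContinuousLinearMap.compL ℝ (Euc m) (Euc n) (Euc n) q.1) := by
      fun_prop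
    have h3 : ContDiff ℝ ∞ (fun q : (Euc n →L[ℝ] Euc n) × (Euc m →L[ℝ] Euc m) =>
        (ContinuousLinearMap.compL ℝ (Euc m) (Euc m) (Euc n)).flip q.2) := by
      fun_prop
    exact h1.smul (h2.clm_comp h3).contDiffAt
  exact hF.contMDiffAt.comp (f := fun y =>
    (baseJacobian κ κ' id (π.proj y), vertJacobian κ' κ id y)) y (hA.prodMk_space hB)

variable [IsManifold 𝓘(ℝ, Euc n) ∞ X] [IsManifold 𝓘(ℝ, Euc n × Euc m) ∞ Y]

/-- The Legendre bundle `Π = ⋀ⁿT*X ⊗ V*Y ⊗ TX → Y`. As with Mathlib's tangent bundle, it is the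
smooth vector bundle glued from its fibre coordinates: over each fibred chart an element
`p^λ_i ω ⊗ dy^i ⊗ ∂_λ` is the linear map `p : ℝᵐ → ℝⁿ` with entries `p^λ_i`, and on overlaps
`ω' = det(∂x'/∂x) ω`, `dy'^i = (∂y'^i/∂y^j) dy^j` (vertically) and `∂_μ = (∂x'^λ/∂x^μ) ∂'_λ` give
the momentum transformation law. -/
def legendreCore (π : FibredManifold n m X Y) :
    VectorBundleCore ℝ Y (Euc m →L[ℝ] Euc n) π.FibredChart where
  baseSet κ := κ.total.source
  isOpen_baseSet κ := κ.total.open_source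
  indexAt y := (π.exists_fibredChart y).choose
  mem_baseSet_at y := (π.exists_fibredChart y).choose_spec
  coordChange κ κ' y :=
    momentumTransform (baseJacobian κ κ' id (π.proj y)) (vertJacobian κ' κ id y)
  coordChange_self κ y h p := by
    rw [momentumTransform_apply, baseJacobian_self (κ.proj_mem y h), vertJacobian_self h]
    simp [ContinuousLinearMap.det]
  continuousOn_coordChange κ κ' := (contMDiffOn_momentumTransform κ κ').continuousOn
  coordChange_comp κ κ' κ'' y h p := by
    obtain ⟨⟨h, h'⟩, h''⟩ := h
    have hA := baseJacobian_comp (κ.proj_mem y h) (κ'.proj_mem y h') (κ''.proj_mem y h'')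
    have hB := vertJacobian_comp h'' h' h
    simp only [momentumTransform_apply]
    rw [← hA, ← hB]
    simp only [ContinuousLinearMap.det, ContinuousLinearMap.toLinearMap_comp, LinearMap.det_comp,
      mul_inv, ContinuousLinearMap.comp_smul, ContinuousLinearMap.smul_comp, smul_smul,
      ContinuousLinearMap.comp_assoc]

instance legendreCore_isContMDiff (π : FibredManifold n m X Y) :
    π.legendreCore.IsContMDiff 𝓘(ℝ, Euc n × Euc m) ∞ :=
  ⟨contMDiffOn_momentumTransform⟩

/-- The total space of the Legendre bundle. -/
abbrev Legendre (π : FibredManifold n m X Y) : Type _ := π.legendreCore.TotalSpace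

end Core

/-- The model of the Legendre manifold: coordinates `((x^λ, y^i), p^λ_i)`. -/
abbrev Canon (n m : ℕ) : Type := (Euc n × Euc m) × (Euc m →L[ℝ] Euc n)

/-- The model with corners of the Legendre manifold. -/
abbrev modelLegendre (n m : ℕ) := (𝓘(ℝ, Euc n × Euc m)).prod 𝓘(ℝ, Euc m →L[ℝ] Euc n)

section Forms

variable {V : Type*} [NormedAddCommGroup V] [NormedSpace ℝ V]

/-- The exterior product `α ∧ η` of a `1`-form and a `k`-form on a vector space. -/
def wedge {k : ℕ} (α : V →L[ℝ] ℝ) (η : V [⋀^Fin k]→L[ℝ] ℝ) : V [⋀^Fin (k + 1)]→L[ℝ] ℝ :=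
  ContinuousAlternatingMap.alternatizeUncurryFin (α.smulRight η)

/-- The volume form `ω = dx¹ ∧ ⋯ ∧ dxⁿ` on `ℝⁿ`. -/
def omega (n : ℕ) : Euc n [⋀^Fin n]→L[ℝ] ℝ :=
  { (EuclideanSpace.basisFun (Fin n) ℝ).toBasis.det with
    cont := by
      change Continuous fun v : Fin n → Euc n =>
        (EuclideanSpace.basisFun (Fin n) ℝ).toBasis.det v
      simp only [Module.Basis.det_apply]
      refine Continuous.matrix_det (continuous_matrix fun a b => ?_)
      simp only [Module.Basis.toMatrix_apply, OrthonormalBasis.coe_toBasis_repr_apply,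
        EuclideanSpace.basisFun_repr]
      exact (EuclideanSpace.proj (𝕜 := ℝ) a).continuous.comp (continuous_apply b) }

/-- The `(n+1)`-form `dy^i ∧ ω` on `ℝⁿ × ℝᵐ`. -/
def dyOmega (n : ℕ) {m : ℕ} (i : Fin m) : (Euc n × Euc m) [⋀^Fin (n + 1)]→L[ℝ] ℝ :=
  wedge (EuclideanSpace.proj i ∘L ContinuousLinearMap.snd ℝ (Euc n) (Euc m))
    ((omega n).compContinuousLinearMap (ContinuousLinearMap.fst ℝ (Euc n) (Euc m)))

/-- The coordinate covector `dp^λ_i`. -/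
def dp {n m : ℕ} (l : Fin n) (i : Fin m) : Canon n m →L[ℝ] ℝ :=
  EuclideanSpace.proj l ∘L
    ContinuousLinearMap.apply ℝ (Euc n) (EuclideanSpace.single i (1 : ℝ)) ∘L
      ContinuousLinearMap.snd ℝ (Euc n × Euc m) (Euc m →L[ℝ] Euc n)

/-- The coordinate expression `dp^λ_i ∧ dy^i ∧ ω ⊗ ∂_λ` (summed over `λ` and `i`). -/
def omegaModel (n m : ℕ) : Canon n m [⋀^Fin (n + 2)]→L[ℝ] Euc n :=
  ∑ l : Fin n, ∑ i : Fin m,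
    (ContinuousLinearMap.toSpanSingleton ℝ (EuclideanSpace.single l (1 : ℝ))
      ).compContinuousAlternatingMap
      (wedge (dp l i) ((dyOmega n i).compContinuousLinearMap
        (ContinuousLinearMap.fst ℝ (Euc n × Euc m) (Euc m →L[ℝ] Euc n))))

end Forms

variable [IsManifold 𝓘(ℝ, Euc n) ∞ X] [IsManifold 𝓘(ℝ, Euc n × Euc m) ∞ Y]
  {π : FibredManifold n m X Y}

/-- The canonical coordinates `((x^λ, y^i), p^λ_i)` on the Legendre manifold over a fibred
chart. -/
def canonicalCoord (κ : π.FibredChart) (q : π.Legendre) : Canon n m :=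
  (κ.total q.proj, (π.legendreCore.localTriv κ q).2)

/-- The value at `q` of the multisymplectic form `Ω = dp^λ_i ∧ dy^i ∧ ω ⊗ ∂_λ`, a `TX`-valued
`(n+2)`-form on the Legendre manifold, written in the canonical coordinates over a fibred chart
`κ` around `q`. -/
def multisymplecticForm (κ : π.FibredChart) (q : π.Legendre) :
    TangentSpace (modelLegendre n m) q [⋀^Fin (n + 2)]→L[ℝ]
      TangentSpace 𝓘(ℝ, Euc n) (π.proj q.proj) :=
  ((mfderiv 𝓘(ℝ, Euc n) 𝓘(ℝ, Euc n) κ.base.symm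
      (κ.base (π.proj q.proj))).compContinuousAlternatingMap (omegaModel n m)
    ).compContinuousLinearMap (mfderiv (modelLegendre n m) 𝓘(ℝ, Canon n m) (canonicalCoord κ) q)

/-- Multisymplectic diffeomorphisms: isomorphisms of the fibred manifold `Π → X` (over some
diffeomorphism `f` of `X`, with no condition with respect to `Y`) that preserve `Ω`. -/
def IsMultisymplectic
    (Φ : π.Legendre ≃ₘ⟮modelLegendre n m, modelLegendre n m⟯ π.Legendre) : Prop :=
  ∃ f : X ≃ₘ⟮𝓘(ℝ, Euc n), 𝓘(ℝ, Euc n)⟯ X,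
    (∀ q : π.Legendre, π.proj (Φ q).proj = f (π.proj q.proj)) ∧
    ∀ (q : π.Legendre) (κ κ' : π.FibredChart),
      q.proj ∈ κ.total.source → (Φ q).proj ∈ κ'.total.source →
      ∀ u : Fin (n + 2) → TangentSpace (modelLegendre n m) q,
        multisymplecticForm κ' (Φ q)
            (fun a => mfderiv (modelLegendre n m) (modelLegendre n m) Φ q (u a)) =
          mfderiv 𝓘(ℝ, Euc n) 𝓘(ℝ, Euc n) f (π.proj q.proj) (multisymplecticForm κ q u)

/-- Isomorphisms of the Legendre manifold: those induced on `⋀ⁿT*X ⊗ V*Y ⊗ TX` by an isomorphism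
`(φ, f)` of the fibred manifold `Y → X`. In canonical coordinates such an isomorphism is
`x' = f(x)`, `y' = φ(x, y)`, `p'^λ_i = J (∂y^j/∂y'^i) (∂x'^λ/∂x^μ) p^μ_j`. -/
def IsLegendreIso
    (G : π.Legendre ≃ₘ⟮modelLegendre n m, modelLegendre n m⟯ π.Legendre) : Prop :=
  ∃ (φ : Y ≃ₘ⟮𝓘(ℝ, Euc n × Euc m), 𝓘(ℝ, Euc n × Euc m)⟯ Y)
    (f : X ≃ₘ⟮𝓘(ℝ, Euc n), 𝓘(ℝ, Euc n)⟯ X),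
    (∀ y, π.proj (φ y) = f (π.proj y)) ∧
    (∀ q : π.Legendre, (G q).proj = φ q.proj) ∧
    ∀ (q : π.Legendre) (κ κ' : π.FibredChart),
      q.proj ∈ κ.total.source → φ q.proj ∈ κ'.total.source →
      (canonicalCoord κ' (G q)).2 =
        momentumTransform (baseJacobian κ κ' f (π.proj q.proj))
          (vertJacobian κ' κ φ.symm (φ q.proj)) (canonicalCoord κ q).2

/-- Smooth sections `r = r^λ_i dy^i ∧ ω ⊗ ∂_λ` of the Legendre bundle `Π → Y`. -/
abbrev LegendreSection (π : FibredManifold n m X Y) :=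
  ContMDiffSection 𝓘(ℝ, Euc n × Euc m) (Euc m →L[ℝ] Euc n) ∞ π.legendreCore.Fiber

/-- Smooth exterior `1`-forms on `X`. -/
abbrev OneForm (n : ℕ) (X : Type*) [TopologicalSpace X] [ChartedSpace (Euc n) X]
    [IsManifold 𝓘(ℝ, Euc n) ∞ X] :=
  ContMDiffSection 𝓘(ℝ, Euc n) (Euc n →L[ℝ] ℝ) ∞
    (fun x : X => TangentSpace 𝓘(ℝ, Euc n) x →L[ℝ] Bundle.Trivial X ℝ x)

/-- The affine bundle morphism `q ↦ q + r(π_{ΠY}(q))` of `Π → Y`. -/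
def translation (r : LegendreSection π) (q : π.Legendre) : π.Legendre :=
  ⟨q.proj, q.snd + r q.proj⟩

/-- The coordinate function `r^λ_i` of a section `r` in a fibred chart. -/
def sectionCoord (r : LegendreSection π) (κ : π.FibredChart) (l : Fin n) (i : Fin m)
    (z : Euc n × Euc m) : ℝ :=
  (canonicalCoord κ ⟨κ.total.symm z, r (κ.total.symm z)⟩).2 (EuclideanSpace.single i 1) l

/-- The coordinate function `φ_λ` of a `1`-form `φ` on `X`. -/
def oneFormCoord (φ : OneForm n X) (κ : π.FibredChart) (l : Fin n) (x : Euc n) : ℝ :=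
  φ (κ.base.symm x)
    (mfderiv 𝓘(ℝ, Euc n) 𝓘(ℝ, Euc n) κ.base.symm x (EuclideanSpace.single l (1 : ℝ)))

/-- The coordinate expression `r^λ_i φ_λ dy^i ∧ ω` of the `(n+1)`-form `r⌋φ` on `Y`. -/
def contractionForm (r : LegendreSection π) (φ : OneForm n X) (κ : π.FibredChart)
    (z : Euc n × Euc m) : (Euc n × Euc m) [⋀^Fin (n + 1)]→L[ℝ] ℝ :=
  ∑ l : Fin n, ∑ i : Fin m,
    (sectionCoord r κ l i z * oneFormCoord φ κ l z.1) • dyOmega n i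

/-- The form `r⌋φ` on `Y` is closed. -/
def ContractionClosed (r : LegendreSection π) (φ : OneForm n X) : Prop :=
  ∀ κ : π.FibredChart, ∀ z ∈ κ.total.target, extDeriv (contractionForm r φ κ) z = 0

end FibredManifold
end Multisymplectic
end

open Multisymplectic Multisymplectic.FibredManifold

/-!
# Multisymplectic diffeomorphisms of the Legendre bundle

In canonical coordinates a diffeomorphism `Φ` of `Π` over a diffeomorphism `f` of `X`, with base
Jacobian `A`, multiplies `ω` by `det A`, and a form `β ∧ ω` depends only on the values of `β` on
vectors vertical over `X`. Hence `Φ` preserves `Ω` if and only if its differential `L` satisfies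
`det A • ⟨L u, L v⟩ = A ⟨u, v⟩` for vertical `u` and `v`, where `⟨(η, p), (η', p')⟩ = p η' - p' η`
is an `ℝⁿ`-valued pairing (`multisymplecticForm_map_eq_iff`). All the rest is read off from this
criterion.

* If `η ≠ 0`, pairing with `(η, p)` maps onto `ℝⁿ`, while pairing with `(0, p)` for `p` of rank one
  only fills a line. For `n ≥ 2` a map `L` as above therefore preserves the momentum directions
  (`snd_fst_map_momentum_eq_zero`); for `n = 0` there are none. So `Φ` is fibred over `Y`, and the
  inverse of `Φ` shows that the induced map `φ` of `Y` is a diffeomorphism.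
* The criterion then determines `∂p'/∂p`, which is the momentum transformation of `(φ, f)` and does
  not depend on `p`. Thus `Φ` is affine along the fibres, and its composition with the translation
  by minus the image of the zero section is the isomorphism induced by `φ`
  (`IsMultisymplectic.exists_eq_translation_comp`).
* Isomorphisms are multisymplectic because second derivatives are symmetric
  (`IsLegendreIso.isMultisymplectic`). Applied to the identity this gives the independence of `Ω`
  from the coordinates.
* A translation `τ_r` is multisymplectic if and only if `∂_j r^λ_i = ∂_i r^λ_j`
  (`isMultisymplectic_translation_iff`), which is also the condition for all `r⌋φ` to be closed
  (`contractionClosed_iff_hasSymmetricDerivative`).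

Since multisymplectic diffeomorphisms form a group, the closedness of the section `r` in
`Φ = τ_r ∘ G` and that of the conjugated section in `G ∘ τ_r = τ_{r'} ∘ G` both follow from the
multisymplecticity of the translations. The factors are unique because isomorphisms preserve the
zero section.
-/

noncomputable section

set_option linter.unusedSectionVars false

namespace Multisymplectic
namespace FibredManifold

/-! ### Linear algebra of the multisymplectic form -/

section
variable {n m : ℕ}

/-- The `ℝⁿ`-valued pairing `p(η') - p'(η)` of `((ξ, η), p)` and `((ξ', η'), p')`, that is, the
`2`-form `dp^λ_i ∧ dy^i ⊗ ∂_λ`. -/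
def momentumPairing (u v : Canon n m) : Euc n := u.2 v.1.2 - v.2 u.1.2

/-- Plugging two vectors `u`, `v` that are vertical over the base into `α ∧ dy^i ∧ ω` leaves
`α(u) dy^i(v) - α(v) dy^i(u)` times the volume form of the base. -/
theorem wedge_dyOmega_cons_cons (α : Canon n m →L[ℝ] ℝ) (i : Fin m) (u v : Canon n m)
    (w : Fin n → Canon n m) (hu : u.1.1 = 0) (hv : v.1.1 = 0) :
    wedge α ((dyOmega n i).compContinuousLinearMap
        (ContinuousLinearMap.fst ℝ (Euc n × Euc m) (Euc m →L[ℝ] Euc n)))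
        (Fin.cons u (Fin.cons v w) : Fin (n + 2) → Canon n m) =
      omega n (fun a => (w a).1.1) * (α u * v.1.2 i - α v * u.1.2 i) := by
  -- `dy^i ∧ ω` on a family that starts with one vertical vector.
  have key : ∀ (i : Fin m) (z : Canon n m), z.1.1 = 0 →
      dyOmega n i (fun a => (Fin.cons z w : Fin (n + 1) → Canon n m) a |>.1) =
       omega n (fun a => (w a).1.1) * z.1.2 i := by
    intro i z hz
    rw [dyOmega, wedge, ContinuousAlternatingMap.alternatizeUncurryFin_apply, Fin.sum_univ_succ,
      Finset.sum_eq_zero]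
    · simp [mul_comm, Function.comp_def, Fin.tail]
    · intro a _
      have : omega n (fun b => ((Fin.cons z w : Fin (n + 1) → Canon n m) (a.succ.succAbove b)).1.1)
          = 0 := by
        have hn : NeZero n := ⟨by rintro rfl; exact a.elim0⟩
        refine (omega n).map_coord_zero 0 ?_
        obtain ⟨k, rfl⟩ : ∃ k, n = k + 1 := Nat.exists_eq_succ_of_ne_zero hn.out
        simpa using hz
      simp [Fin.removeNth, Function.comp_def, this]
  -- If both `u` and `v` are kept, one of them ends up in `ω`.
  have key0 : ∀ (i : Fin m) (a : Fin n),
      dyOmega n i (fun b => ((Fin.cons u (Fin.cons v w : Fin (n + 1) → Canon n m) :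
        Fin (n + 2) → Canon n m) (a.succ.succ.succAbove b)).1) = 0 := by
    intro i a
    have hn : NeZero n := ⟨by rintro rfl; exact a.elim0⟩
    rw [dyOmega, wedge, ContinuousAlternatingMap.alternatizeUncurryFin_apply]
    refine Finset.sum_eq_zero fun b _ => ?_
    obtain ⟨k, rfl⟩ : ∃ k, n = k + 1 := Nat.exists_eq_succ_of_ne_zero hn.out
    have : omega (k + 1) (fun c => ((Fin.cons u (Fin.cons v w : Fin (k + 2) → Canon (k + 1) m) :
        Fin (k + 3) → Canon (k + 1) m) (a.succ.succ.succAbove (b.succAbove c))).1.1) = 0 := by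
      refine (omega (k + 1)).map_coord_zero 0 ?_
      cases b using Fin.cases with
      | zero => simpa using hv
      | succ b => simpa using hu
    simp [Fin.removeNth, Function.comp_def, this]
  rw [wedge, ContinuousAlternatingMap.alternatizeUncurryFin_apply, Fin.sum_univ_succ,
    Fin.sum_univ_succ, Finset.sum_eq_zero]
  · have h1 := key i v hv
    have h2 := key i u hu
    have e1 : (fun a => ((Fin.cons u (Fin.cons v w : Fin (n + 1) → Canon n m) :
        Fin (n + 2) → Canon n m) ((0 : Fin (n + 1)).succ.succAbove a)).1) =
        (fun a => (Fin.cons u w : Fin (n + 1) → Canon n m) a |>.1) := by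
      funext a
      cases a using Fin.cases with
      | zero => simp
      | succ b => simp
    simp only [Fin.removeNth, ContinuousLinearMap.smulRight_apply,
      ContinuousAlternatingMap.smul_apply, ContinuousAlternatingMap.compContinuousLinearMap_apply,
      Function.comp_def, ContinuousLinearMap.coe_fst', smul_eq_mul, e1, h2, Fin.succAbove_zero,
      Fin.cons_succ, h1, Fin.cons_zero]
    simp
    ring
  · intro a _
    simp [Fin.removeNth, Function.comp_def, key0 i a]

theorem apply_eq_sum_single (p : Euc m →L[ℝ] Euc n) (η : Euc m) (l : Fin n) :
    p η l = ∑ i, p (EuclideanSpace.single i 1) l * η i := by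
  conv_lhs => rw [← (EuclideanSpace.basisFun (Fin m) ℝ).sum_repr η]
  simp [mul_comm]

/-- Plugging two vectors that are vertical over the base into `dp^λ_i ∧ dy^i ∧ ω ⊗ ∂_λ` leaves the
pairing of these two vectors times the volume form of the base. -/
theorem omegaModel_cons_cons (u v : Canon n m) (w : Fin n → Canon n m)
    (hu : u.1.1 = 0) (hv : v.1.1 = 0) :
    omegaModel n m (Fin.cons u (Fin.cons v w) : Fin (n + 2) → Canon n m) =
      omega n (fun a => (w a).1.1) • momentumPairing u v := by
  simp only [omegaModel, ContinuousAlternatingMap.sum_apply,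
    ContinuousLinearMap.compContinuousAlternatingMap_coe, Function.comp_apply,
    wedge_dyOmega_cons_cons _ _ u v w hu hv]
  ext l
  have hp : momentumPairing u v l = ∑ i, (u.2 (EuclideanSpace.single i 1) l * v.1.2 i -
      v.2 (EuclideanSpace.single i 1) l * u.1.2 i) := by
    rw [momentumPairing, PiLp.sub_apply, apply_eq_sum_single, apply_eq_sum_single,
      Finset.sum_sub_distrib]
  rw [PiLp.smul_apply, hp, smul_eq_mul, WithLp.ofLp_sum, Finset.sum_apply,
    Finset.sum_eq_single l]
  · simp [dp, Finset.mul_sum, mul_sub, Finset.sum_sub_distrib]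
  · intro l' _ hl
    simp [hl.symm]
  · simp

/-- Alternating maps of degree `n + 2` agree as soon as they agree on all families that start with
two vectors vertical over the `n`-dimensional base: of any `n + 2` distinct vectors of a basis
adapted to the base, at least two are vertical. -/
theorem alternating_eq_of_vertical {F : Type*} [NormedAddCommGroup F] [NormedSpace ℝ F]
    {β γ : Canon n m [⋀^Fin (n + 2)]→L[ℝ] F}
    (h : ∀ (u v : Canon n m) (w : Fin n → Canon n m), u.1.1 = 0 → v.1.1 = 0 →
      β (Fin.cons u (Fin.cons v w) : Fin (n + 2) → Canon n m) =
      γ (Fin.cons u (Fin.cons v w) : Fin (n + 2) → Canon n m)) : β = γ := by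
  apply ContinuousAlternatingMap.toAlternatingMap_injective
  let b := (((EuclideanSpace.basisFun (Fin n) ℝ).toBasis.prod
    (EuclideanSpace.basisFun (Fin m) ℝ).toBasis).prod (Module.finBasis ℝ (Euc m →L[ℝ] Euc n)))
  refine b.ext_alternating fun v hv => ?_
  -- The positions of the basis vectors that are not vertical.
  let S : Finset (Fin (n + 2)) := {a | ∃ k : Fin n, v a = Sum.inl (Sum.inl k)}
  have hS : S.card ≤ n := by
    rw [← Finset.card_image_of_injective S hv]
    refine (Finset.card_le_card
      (t := Finset.univ.image fun k : Fin n => Sum.inl (Sum.inl k)) ?_).trans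
      (Finset.card_image_le.trans (by simp))
    intro c hc
    simp only [S, Finset.mem_image, Finset.mem_filter, Finset.mem_univ, true_and] at hc ⊢
    obtain ⟨a, ⟨k, hk⟩, rfl⟩ := hc
    exact ⟨k, hk.symm⟩
  have hSc : 1 < Sᶜ.card := by
    rw [Finset.card_compl, Fintype.card_fin]; omega
  obtain ⟨a, a', ha, ha', hne⟩ := Finset.one_lt_card_iff.1 hSc
  have hz : ∀ a ∈ Sᶜ, (b (v a)).1.1 = 0 := by
    intro a ha
    have : ∀ k : Fin n, v a ≠ Sum.inl (Sum.inl k) := by simpa [S] using ha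
    rcases hva : v a with (k | k) | k
    · exact absurd hva (this k)
    · simp [b]
    · simp [b]
  -- A permutation that moves the vertical positions `a`, `a'` to the front.
  let σ : Equiv.Perm (Fin (n + 2)) := Equiv.swap 1 (Equiv.swap 0 a a') |>.trans (Equiv.swap 0 a)
  have h1 : Equiv.swap 0 a a' ≠ 0 := by
    intro h0
    rw [Equiv.swap_apply_eq_iff, Equiv.swap_apply_left] at h0
    exact hne h0.symm
  have hσ0 : σ 0 = a := by
    simp only [σ, Equiv.trans_apply]
    rw [Equiv.swap_apply_of_ne_of_ne (by simp) h1.symm, Equiv.swap_apply_left]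
  have hσ1 : σ 1 = a' := by
    simp [σ]
  have hcons : (fun c => b (v (σ c))) = (Fin.cons (b (v a)) (Fin.cons (b (v a'))
     (fun c => b (v (σ c.succ.succ)))) : Fin (n + 2) → Canon n m) := by
    funext c
    cases c using Fin.cases with
    | zero => simp [hσ0]
    | succ c =>
      cases c using Fin.cases with
      | zero => simp [hσ1]
      | succ c => simp
  have hfin := h _ _ (fun c => b (v (σ c.succ.succ))) (hz a ha) (hz a' ha')
  rw [← hcons] at hfin
  have hβ := β.toAlternatingMap.map_perm (fun c => b (v c)) σ
  have hγ := γ.toAlternatingMap.map_perm (fun c => b (v c)) σ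
  have : (Equiv.Perm.sign σ) • β.toAlternatingMap (fun c => b (v c)) =
     (Equiv.Perm.sign σ) • γ.toAlternatingMap (fun c => b (v c)) := by
    rw [← hβ, ← hγ]
    exact hfin
  exact smul_left_cancel _ this

theorem omega_single : omega n (fun a => EuclideanSpace.single a (1 : ℝ)) = 1 := by
  have h := (EuclideanSpace.basisFun (Fin n) ℝ).toBasis.det_self
  have hb : ⇑(EuclideanSpace.basisFun (Fin n) ℝ).toBasis =
      fun a => EuclideanSpace.single a (1 : ℝ) := by
    funext a
    simp
  rw [hb] at h
  exact h

theorem omega_map (A : Euc n →L[ℝ] Euc n) (w : Fin n → Euc n) :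
    omega n (fun a => A (w a)) = A.det * omega n w := by
  exact (EuclideanSpace.basisFun (Fin n) ℝ).toBasis.det_comp A.toLinearMap w

/-- A linear map over an isomorphism `A` of the base preserves `dp^λ_i ∧ dy^i ∧ ω ⊗ ∂_λ` if and
only if it rescales the pairing of vertical vectors by `(det A)⁻¹ A`. -/
theorem omegaModel_map_eq_iff {A : Euc n →L[ℝ] Euc n}
    {L : Canon n m →L[ℝ] Canon n m} (hL : ∀ u, (L u).1.1 = A u.1.1) :
    (∀ u : Fin (n + 2) → Canon n m, omegaModel n m (fun a => L (u a)) = A (omegaModel n m u)) ↔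
      ∀ u v : Canon n m, u.1.1 = 0 → v.1.1 = 0 →
        A.det • momentumPairing (L u) (L v) = A (momentumPairing u v) := by
  have hc : ∀ (u v : Canon n m) (w : Fin n → Canon n m),
      (fun a => L ((Fin.cons u (Fin.cons v w) : Fin (n + 2) → Canon n m) a)) =
        (Fin.cons (L u) (Fin.cons (L v) (fun a => L (w a))) : Fin (n + 2) → Canon n m) := by
    intro u v w
    funext c
    cases c using Fin.cases with
    | zero => simp
    | succ c =>
      cases c using Fin.cases with
      | zero => simp
      | succ c => simp
  constructor
  · intro h u v hu hv
    have := h (Fin.cons u (Fin.cons v (fun a => ((EuclideanSpace.single a (1 : ℝ), 0), 0))))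
    rw [hc, omegaModel_cons_cons _ _ _ hu hv,
      omegaModel_cons_cons _ _ _ (by simp [hL, hu]) (by simp [hL, hv])] at this
    simpa [hL, omega_map, omega_single] using this
  · intro h
    have : (omegaModel n m).compContinuousLinearMap L =
        A.compContinuousAlternatingMap (omegaModel n m) := by
      refine alternating_eq_of_vertical fun u v w hu hv => ?_
      change omegaModel n m (fun a => L _) = A (omegaModel n m _)
      rw [hc, omegaModel_cons_cons _ _ _ hu hv,
        omegaModel_cons_cons _ _ _ (by simp [hL, hu]) (by simp [hL, hv])]
      simp only [hL, omega_map, map_smul, ← h u v hu hv, smul_smul]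
      rw [mul_comm]
    intro u
    exact congrArg (fun β => β u) this

/-- If `n ≥ 2`, the momentum directions are singled out by the pairing: a vector with a nonzero
`y`-component pairs onto the whole of `ℝⁿ`, while pure momenta of rank one pair onto lines. -/
theorem snd_fst_map_momentum_eq_zero (hn : n ≠ 1) {A : Euc n →L[ℝ] Euc n} (hA : A.det ≠ 0)
    {L : Canon n m →L[ℝ] Canon n m} (hL : ∀ u, (L u).1.1 = A u.1.1)
    (h : ∀ u v : Canon n m, u.1.1 = 0 → v.1.1 = 0 →
        A.det • momentumPairing (L u) (L v) = A (momentumPairing u v)) (p : Euc m →L[ℝ] Euc n) :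
    (L (0, p)).1.2 = 0 := by
  -- For `n = 0` there are no momenta.
  rcases Nat.lt_or_ge n 2 with h2 | h2
  · obtain rfl : n = 0 := by omega
    have : p = 0 := by
      ext v l
      exact l.elim0
    rw [this, Prod.mk_zero_zero, map_zero]
    rfl
  have hAinj : Function.Injective A := by
    have := LinearMap.isUnit_iff_ker_eq_bot A.toLinearMap |>.1
      ((LinearMap.isUnit_iff_isUnit_det _).2 (isUnit_iff_ne_zero.2 hA))
    exact LinearMap.ker_eq_bot.1 this
  -- The pairing is nondegenerate, so `L` is onto the vertical vectors.
  let ι : (Euc m × (Euc m →L[ℝ] Euc n)) →ₗ[ℝ] Canon n m :=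
    { toFun := fun w => ((0, w.1), w.2)
      map_add' := fun a b => by simp
      map_smul' := fun a b => by simp }
  let ρ : Canon n m →ₗ[ℝ] (Euc m × (Euc m →L[ℝ] Euc n)) :=
    { toFun := fun w => (w.1.2, w.2)
      map_add' := fun a b => by simp
      map_smul' := fun a b => by simp }
  let LW := ρ ∘ₗ L.toLinearMap ∘ₗ ι
  have hLW : ∀ w, L (ι w) = ι (LW w) := by
    intro w
    refine Prod.ext (Prod.ext ?_ rfl) rfl
    change (L (ι w)).1.1 = 0
    rw [hL]
    exact map_zero A
  have hinj : Function.Injective LW := by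
    rw [injective_iff_map_eq_zero]
    intro w hw
    have h0 : ∀ v, momentumPairing (ι w) (ι v) = 0 := by
      intro v
      have := h (ι w) (ι v) rfl rfl
      rw [hLW, hw, map_zero] at this
      apply hAinj
      rw [← this]
      simp [momentumPairing]
    have h1 : w.1 = 0 := by
      ext i
      have := h0 (0, (EuclideanSpace.proj i).smulRight (EuclideanSpace.single ⟨0, by omega⟩ 1))
      have := congrArg (fun ξ : Euc n => ξ ⟨0, by omega⟩) this
      simpa [momentumPairing, ι] using this
    have h2 : w.2 = 0 := by
      ext η l
      have := congrArg (fun ξ : Euc n => ξ l) (h0 (η, 0))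
      simpa [momentumPairing, ι] using this
    exact Prod.ext h1 h2
  have hsurj : Function.Surjective LW := LinearMap.injective_iff_surjective.1 hinj
  have rank_one : ∀ (i : Fin m) (ξ : Euc n),
      (L (0, (EuclideanSpace.proj i : Euc m →L[ℝ] ℝ).smulRight ξ)).1.2 = 0 := by
    intro i ξ
    by_contra hη
    set u : Canon n m := (0, (EuclideanSpace.proj i : Euc m →L[ℝ] ℝ).smulRight ξ) with hu
    have hx : (L u).1.1 = 0 := by rw [hL]; exact map_zero A
    -- Otherwise the line spanned by `A ξ` would be the whole of `ℝⁿ`.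
    have htop : ∀ ζ : Euc n, ∃ c : ℝ, c • A ξ = ζ := by
      intro ζ
      obtain ⟨k, hk⟩ : ∃ k, (L u).1.2 k ≠ 0 := by
        by_contra! hall
        exact hη (by ext k; simpa using hall k)
      obtain ⟨v, hv⟩ := hsurj (0, -((L u).1.2 k)⁻¹ •
        (EuclideanSpace.proj k : Euc m →L[ℝ] ℝ).smulRight ((A.det)⁻¹ • ζ))
      have := h u (ι v) rfl rfl
      rw [hLW, hv] at this
      have e1 : momentumPairing u (ι v) = v.1 i • ξ := by
        simp [momentumPairing, hu, ι]
      rw [e1] at this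
      refine ⟨v.1 i, ?_⟩
      rw [← map_smul, ← this]
      simp [momentumPairing, ι, smul_smul, hk, hA]
    have := finrank_le_one (A ξ) htop
    simp at this
    omega
  have hp : p = ∑ i, (EuclideanSpace.proj i : Euc m →L[ℝ] ℝ).smulRight
      (p (EuclideanSpace.single i 1)) := by
    refine ContinuousLinearMap.ext fun η => ?_
    conv_lhs => rw [← (EuclideanSpace.basisFun (Fin m) ℝ).sum_repr η]
    simp
  have hlin : (L (0, p)).1.2 = ∑ i, (L (0, (EuclideanSpace.proj i : Euc m →L[ℝ] ℝ).smulRight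
      (p (EuclideanSpace.single i 1)))).1.2 := by
    let T : (Euc m →L[ℝ] Euc n) →ₗ[ℝ] Euc m :=
      LinearMap.fst ℝ _ _ ∘ₗ ρ ∘ₗ L.toLinearMap ∘ₗ LinearMap.inr ℝ _ _
    exact (congrArg T hp).trans (map_sum T _ _)
  rw [hlin]
  exact Finset.sum_eq_zero fun i _ => rank_one i _

/-- If a linear map rescales the pairing and preserves the momentum directions, its action on the
momenta is determined by its action on the `y`-directions. -/
theorem snd_map_momentum_comp {A : Euc n →L[ℝ] Euc n} (hA : A.det ≠ 0)
    {L : Canon n m →L[ℝ] Canon n m}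
    (h : ∀ u v : Canon n m, u.1.1 = 0 → v.1.1 = 0 →
        A.det • momentumPairing (L u) (L v) = A (momentumPairing u v))
    (h0 : ∀ p : Euc m →L[ℝ] Euc n, (L (0, p)).1.2 = 0) (p : Euc m →L[ℝ] Euc n) (η : Euc m) :
    (L (0, p)).2 (L ((0, η), 0)).1.2 = A.det⁻¹ • A (p η) := by
  have := h (0, p) ((0, η), 0) rfl rfl
  simp only [momentumPairing, h0] at this
  rw [eq_inv_smul_iff₀ hA]
  simpa using this

end

/-! ### Representatives of maps in fibred and canonical coordinates -/

section

section ChartRepresentatives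

variable {E H M E' H' M' M'' : Type*}
  [NormedAddCommGroup E] [NormedSpace ℝ E] [TopologicalSpace H] {I : ModelWithCorners ℝ E H}
  [TopologicalSpace M] [ChartedSpace H M]
  [NormedAddCommGroup E'] [NormedSpace ℝ E'] [TopologicalSpace H'] {I' : ModelWithCorners ℝ E' H'}
  [TopologicalSpace M'] [ChartedSpace H' M']
  {K K' K'' : Type*} [NormedAddCommGroup K] [NormedSpace ℝ K]
  [NormedAddCommGroup K'] [NormedSpace ℝ K'] [NormedAddCommGroup K''] [NormedSpace ℝ K'']

theorem contDiffAt_chart_comp {e : OpenPartialHomeomorph M K} {e' : OpenPartialHomeomorph M' K'}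
    {g : M → M'} {x : M} (hx : x ∈ e.source)
    (he : ContMDiffAt 𝓘(ℝ, K) I ∞ e.symm (e x)) (hg : ContMDiffAt I I' ∞ g x)
    (he' : ContMDiffAt I' 𝓘(ℝ, K') ∞ e' (g x)) :
    ContDiffAt ℝ ∞ (e' ∘ g ∘ e.symm) (e x) := by
  rw [← contMDiffAt_iff_contDiffAt]
  rw [← e.left_inv hx] at hg he'
  exact ContMDiffAt.comp (g := e') (f := g ∘ e.symm) (e x) he' (hg.comp (e x) he)

theorem fderiv_chart_comp [TopologicalSpace M''] {e : OpenPartialHomeomorph M K}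
    {e' : OpenPartialHomeomorph M' K'} {e'' : OpenPartialHomeomorph M'' K''}
    {g : M → M'} {h : M' → M''} {x : M} (hx : x ∈ e.source) (hx' : g x ∈ e'.source)
    (hg : ContinuousAt g x) (h1 : ContDiffAt ℝ ∞ (e' ∘ g ∘ e.symm) (e x))
    (h2 : ContDiffAt ℝ ∞ (e'' ∘ h ∘ e'.symm) (e' (g x))) :
    fderiv ℝ (e'' ∘ h ∘ e'.symm) (e' (g x)) ∘L fderiv ℝ (e' ∘ g ∘ e.symm) (e x) =
      fderiv ℝ (e'' ∘ (h ∘ g) ∘ e.symm) (e x) := by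
  have hxx : (e' ∘ g ∘ e.symm) (e x) = e' (g x) := by simp [e.left_inv hx]
  have h1' := h1.differentiableAt (by simp)
  have h2' := h2.differentiableAt (by simp)
  rw [← hxx] at h2'
  have hcomp := fderiv_comp _ h2' h1'
  rw [hxx] at hcomp
  rw [← hcomp]
  refine Filter.EventuallyEq.fderiv_eq ?_
  have hc := e.continuousAt_symm (e.map_source hx)
  rw [← e.left_inv hx] at hg
  have hm : e'.source ∈ nhds (g (e.symm (e x))) := by
    rw [e.left_inv hx]; exact e'.open_source.mem_nhds hx'
  filter_upwards [(hg.comp hc) hm] with z hz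
  have hz : g (e.symm z) ∈ e'.source := hz
  simp [e'.left_inv hz]

theorem fderiv_chart_id {e : OpenPartialHomeomorph M K} {x : M} (hx : x ∈ e.source) :
    fderiv ℝ (e ∘ id ∘ e.symm) (e x) = ContinuousLinearMap.id ℝ K := by
  have : e ∘ id ∘ e.symm =ᶠ[nhds (e x)] id := by
    filter_upwards [e.open_target.mem_nhds (e.map_source hx)] with z hz
    simp [e.right_inv hz]
  rw [this.fderiv_eq, fderiv_id]

/-- The differential of a chart intertwines the differential of a map with that of its
representative. -/
theorem mfderiv_chart_comp {e : OpenPartialHomeomorph M K} {e' : OpenPartialHomeomorph M' K'}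
    {g : M → M'} {x : M} (hx : x ∈ e.source) (he : ContMDiffAt I 𝓘(ℝ, K) ∞ e x)
    (hg : ContMDiffAt I I' ∞ g x)
    (he' : ContMDiffAt I' 𝓘(ℝ, K') ∞ e' (g x))
    (h1 : ContDiffAt ℝ ∞ (e' ∘ g ∘ e.symm) (e x)) (u : TangentSpace I x) :
    (mfderiv I' 𝓘(ℝ, K') e' (g x) (mfderiv I I' g x u) : K') =
      fderiv ℝ (e' ∘ g ∘ e.symm) (e x) (mfderiv I 𝓘(ℝ, K) e x u : K) := by
  have a1 := mfderiv_comp x (he'.mdifferentiableAt (by simp)) (hg.mdifferentiableAt (by simp))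
  have a2 := mfderiv_comp x (h1.contMDiffAt.mdifferentiableAt (by simp))
    (he.mdifferentiableAt (by simp))
  have heq : (e' ∘ g ∘ e.symm) ∘ e =ᶠ[nhds x] e' ∘ g := by
    filter_upwards [e.open_source.mem_nhds hx] with y hy
    simp [e.left_inv hy]
  have a3 := heq.mfderiv_eq (I := I) (I' := 𝓘(ℝ, K'))
  rw [a2, a1, mfderiv_eq_fderiv] at a3
  exact (congrArg (fun T : E →L[ℝ] K' => T u) a3).symm

/-- The inverse of a chart intertwines the representative of a map with its differential. -/
theorem mfderiv_comp_chart_symm {e : OpenPartialHomeomorph M K} {e' : OpenPartialHomeomorph M' K'}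
    {g : M → M'} {x : M} (hx : x ∈ e.source) (hx' : g x ∈ e'.source)
    (he : ContMDiffAt 𝓘(ℝ, K) I ∞ e.symm (e x))
    (hg : ContMDiffAt I I' ∞ g x)
    (he' : ContMDiffAt 𝓘(ℝ, K') I' ∞ e'.symm (e' (g x)))
    (h1 : ContDiffAt ℝ ∞ (e' ∘ g ∘ e.symm) (e x)) (ξ : K) :
    (mfderiv I I' g x (mfderiv 𝓘(ℝ, K) I e.symm (e x) ξ) : E') =
      mfderiv 𝓘(ℝ, K') I' e'.symm (e' (g x)) (fderiv ℝ (e' ∘ g ∘ e.symm) (e x) ξ) := by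
  have hxx : (e' ∘ g ∘ e.symm) (e x) = e' (g x) := by simp [e.left_inv hx]
  have hxe := e.left_inv hx
  have a1 := mfderiv_comp (e x) (I' := I) (g := g) (f := e.symm)
    (by rw [hxe]; exact hg.mdifferentiableAt (by simp)) (he.mdifferentiableAt (by simp))
  have a2 := mfderiv_comp (e x) (I' := 𝓘(ℝ, K')) (g := e'.symm) (f := e' ∘ g ∘ e.symm)
    (by rw [hxx]; exact he'.mdifferentiableAt (by simp))
    (h1.contMDiffAt.mdifferentiableAt (by simp))
  have hc := e.continuousAt_symm (e.map_source hx)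
  have hgc := hg.continuousAt
  rw [← e.left_inv hx] at hgc
  have hm : e'.source ∈ nhds (g (e.symm (e x))) := by
    rw [e.left_inv hx]; exact e'.open_source.mem_nhds hx'
  have heq : e'.symm ∘ (e' ∘ g ∘ e.symm) =ᶠ[nhds (e x)] g ∘ e.symm := by
    filter_upwards [(hgc.comp hc) hm] with z hz
    have hz : g (e.symm z) ∈ e'.source := hz
    simp [e'.left_inv hz]
  have a3 := heq.mfderiv_eq (I := 𝓘(ℝ, K)) (I' := I')
  rw [a2, a1, mfderiv_eq_fderiv, hxx] at a3
  have a4 := (congrArg (fun T : K →L[ℝ] E' => T ξ) a3).symm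
  refine Eq.trans ?_ a4
  change _ = (mfderiv I I' g (e.symm (e x))) (mfderiv 𝓘(ℝ, K) I e.symm (e x) ξ)
  rw [hxe]

theorem mfderiv_chart_symm_apply {e : OpenPartialHomeomorph M K} {x : M} (hx : x ∈ e.source)
    (he : ContMDiffAt I 𝓘(ℝ, K) ∞ e x) (he' : ContMDiffAt 𝓘(ℝ, K) I ∞ e.symm (e x)) (ξ : K) :
    (mfderiv I 𝓘(ℝ, K) e x (mfderiv 𝓘(ℝ, K) I e.symm (e x) ξ) : K) = ξ := by
  have hxe := e.left_inv hx
  have a1 := mfderiv_comp (e x) (I' := I) (g := e) (f := e.symm)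
    (by rw [hxe]; exact he.mdifferentiableAt (by simp)) (he'.mdifferentiableAt (by simp))
  have heq : e ∘ e.symm =ᶠ[nhds (e x)] id := by
    filter_upwards [e.open_target.mem_nhds (e.map_source hx)] with z hz
    simp [e.right_inv hz]
  have a3 := heq.mfderiv_eq (I := 𝓘(ℝ, K)) (I' := 𝓘(ℝ, K))
  rw [a1, mfderiv_id] at a3
  have a4 := congrArg (fun T : K →L[ℝ] K => T ξ) a3
  refine Eq.trans ?_ a4
  change _ = (mfderiv I 𝓘(ℝ, K) e (e.symm (e x))) (mfderiv 𝓘(ℝ, K) I e.symm (e x) ξ)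
  rw [hxe]

end ChartRepresentatives

variable {n m : ℕ} {X Y : Type*}
  [TopologicalSpace X] [ChartedSpace (Euc n) X]
  [TopologicalSpace Y] [ChartedSpace (Euc n × Euc m) Y]
  {π : FibredManifold n m X Y}

section BaseAndTotal

variable {κ κ' κ'' : π.FibredChart}

theorem contMDiffAt_base {x : X} [IsManifold 𝓘(ℝ, Euc n) ∞ X] (h : x ∈ κ.base.source) :
    ContMDiffAt 𝓘(ℝ, Euc n) 𝓘(ℝ, Euc n) ∞ κ.base x :=
  contMDiffAt_of_mem_maximalAtlas κ.base_mem h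

theorem contMDiffAt_base_symm {x : X} [IsManifold 𝓘(ℝ, Euc n) ∞ X] (h : x ∈ κ.base.source) :
    ContMDiffAt 𝓘(ℝ, Euc n) 𝓘(ℝ, Euc n) ∞ κ.base.symm (κ.base x) :=
  contMDiffAt_symm_of_mem_maximalAtlas κ.base_mem (κ.base.map_source h)

theorem contMDiffAt_total [IsManifold 𝓘(ℝ, Euc n × Euc m) ∞ Y] {y : Y} (h : y ∈ κ.total.source) :
    ContMDiffAt 𝓘(ℝ, Euc n × Euc m) 𝓘(ℝ, Euc n × Euc m) ∞ κ.total y :=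
  contMDiffAt_of_mem_maximalAtlas κ.total_mem h

theorem contMDiffAt_total_symm [IsManifold 𝓘(ℝ, Euc n × Euc m) ∞ Y] {y : Y}
    (h : y ∈ κ.total.source) :
    ContMDiffAt 𝓘(ℝ, Euc n × Euc m) 𝓘(ℝ, Euc n × Euc m) ∞ κ.total.symm (κ.total y) :=
  contMDiffAt_symm_of_mem_maximalAtlas κ.total_mem (κ.total.map_source h)

variable [IsManifold 𝓘(ℝ, Euc n) ∞ X]

theorem contDiffAt_baseRep {f : X → X} {x : X} (hf : ContMDiffAt 𝓘(ℝ, Euc n) 𝓘(ℝ, Euc n) ∞ f x)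
    (hx : x ∈ κ.base.source) (hx' : f x ∈ κ'.base.source) :
    ContDiffAt ℝ ∞ (κ'.base ∘ f ∘ κ.base.symm) (κ.base x) :=
  contDiffAt_chart_comp hx (contMDiffAt_base_symm hx) hf (contMDiffAt_base hx')

theorem det_baseJacobian_ne_zero_of_diffeomorph
    (f : X ≃ₘ⟮𝓘(ℝ, Euc n), 𝓘(ℝ, Euc n)⟯ X) {x : X} (hx : x ∈ κ.base.source)
    (hx' : f x ∈ κ'.base.source) : (baseJacobian κ κ' f x).det ≠ 0 := by
  have hs : f.symm (f x) = x := f.symm_apply_apply x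
  have h := fderiv_chart_comp (e'' := κ.base) (h := f.symm) hx hx' f.continuous.continuousAt
    (contDiffAt_baseRep f.contMDiff.contMDiffAt hx hx')
    (contDiffAt_baseRep f.symm.contMDiff.contMDiffAt hx' (by rwa [hs]))
  have hid : ⇑f.symm ∘ ⇑f = id := funext f.symm_apply_apply
  rw [hid, fderiv_chart_id hx] at h
  have h := congrArg ContinuousLinearMap.det h
  simp only [ContinuousLinearMap.det, ContinuousLinearMap.toLinearMap_comp,
    LinearMap.det_comp, ContinuousLinearMap.coe_id, LinearMap.det_id] at h
  exact right_ne_zero_of_mul_eq_one h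

variable [IsManifold 𝓘(ℝ, Euc n × Euc m) ∞ Y]

theorem contDiffAt_totalRep {g : Y → Y} {y : Y}
    (hg : ContMDiffAt 𝓘(ℝ, Euc n × Euc m) 𝓘(ℝ, Euc n × Euc m) ∞ g y)
    (hy : y ∈ κ.total.source) (hy' : g y ∈ κ'.total.source) :
    ContDiffAt ℝ ∞ (κ'.total ∘ g ∘ κ.total.symm) (κ.total y) :=
  contDiffAt_chart_comp hy (contMDiffAt_total_symm hy) hg (contMDiffAt_total hy')

/-- The representative of a map of `Y` over a map of `X` sends vertical vectors to vertical
vectors. -/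
theorem fderiv_totalRep_fst {g : Y → Y} {f : X → X} {y : Y}
    (hg : ContMDiffAt 𝓘(ℝ, Euc n × Euc m) 𝓘(ℝ, Euc n × Euc m) ∞ g y)
    (hf : ContMDiffAt 𝓘(ℝ, Euc n) 𝓘(ℝ, Euc n) ∞ f (π.proj y))
    (hgf : ∀ y, π.proj (g y) = f (π.proj y))
    (hy : y ∈ κ.total.source) (hy' : g y ∈ κ'.total.source) (u : Euc n × Euc m) :
    (fderiv ℝ (κ'.total ∘ g ∘ κ.total.symm) (κ.total y) u).1 =
      baseJacobian κ κ' f (π.proj y) u.1 := by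
  have h1 := ((contDiffAt_totalRep hg hy hy').differentiableAt (by simp)).hasFDerivAt
  have h2 := (ContinuousLinearMap.fst ℝ (Euc n) (Euc m)).hasFDerivAt.comp _ h1
  have hb := ((contDiffAt_baseRep hf (κ.proj_mem y hy)
    (κ' := κ') (by rw [← hgf]; exact κ'.proj_mem _ hy')).differentiableAt (by simp)).hasFDerivAt
  rw [← κ.fst_total y hy] at hb
  have h3 := hb.comp (κ.total y) (ContinuousLinearMap.fst ℝ (Euc n) (Euc m)).hasFDerivAt
  have heq : (ContinuousLinearMap.fst ℝ (Euc n) (Euc m)) ∘ (κ'.total ∘ g ∘ κ.total.symm)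
      =ᶠ[nhds (κ.total y)]
      (κ'.base ∘ f ∘ κ.base.symm) ∘ (ContinuousLinearMap.fst ℝ (Euc n) (Euc m)) := by
    have hc := κ.total.continuousAt_symm (κ.total.map_source hy)
    have hgc := hg.continuousAt
    rw [← κ.total.left_inv hy] at hgc
    have hm : κ'.total.source ∈ nhds (g (κ.total.symm (κ.total y))) := by
      rw [κ.total.left_inv hy]; exact κ'.total.open_source.mem_nhds hy'
    filter_upwards [(hgc.comp hc) hm, κ.total.open_target.mem_nhds (κ.total.map_source hy)]
      with z hz hzt
    have hs := κ.total.map_target hzt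
    have e1 := κ'.fst_total _ hz
    have e2 := κ.fst_total _ hs
    rw [κ.total.right_inv hzt] at e2
    simp only [Function.comp_apply] at e1
    simp [e1, e2, hgf, κ.base.left_inv (κ.proj_mem _ hs)]
  have := (h3.congr_of_eventuallyEq heq).unique h2
  have := congrArg (fun T => T u) this
  rw [κ.fst_total y hy] at this
  simpa [baseJacobian] using this.symm

theorem inr_vertJacobian {g : Y → Y} {f : X → X} {y : Y}
    (hg : ContMDiffAt 𝓘(ℝ, Euc n × Euc m) 𝓘(ℝ, Euc n × Euc m) ∞ g y)
    (hf : ContMDiffAt 𝓘(ℝ, Euc n) 𝓘(ℝ, Euc n) ∞ f (π.proj y))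
    (hgf : ∀ y, π.proj (g y) = f (π.proj y))
    (hy : y ∈ κ.total.source) (hy' : g y ∈ κ'.total.source) (η : Euc m) :
    (0, vertJacobian κ κ' g y η) =
      fderiv ℝ (κ'.total ∘ g ∘ κ.total.symm) (κ.total y) (0, η) := by
  refine Prod.ext ?_ rfl
  rw [fderiv_totalRep_fst hg hf hgf hy hy']
  exact (map_zero _).symm

theorem vertJacobian_symm_apply (φ : Y ≃ₘ⟮𝓘(ℝ, Euc n × Euc m), 𝓘(ℝ, Euc n × Euc m)⟯ Y)
    (f : X ≃ₘ⟮𝓘(ℝ, Euc n), 𝓘(ℝ, Euc n)⟯ X) (hφ : ∀ y, π.proj (φ y) = f (π.proj y)) {y : Y}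
    (hy : y ∈ κ.total.source) (hy' : φ y ∈ κ'.total.source) (η : Euc m) :
    vertJacobian κ' κ φ.symm (φ y) (vertJacobian κ κ' φ y η) = η := by
  have hs : φ.symm (φ y) = y := φ.symm_apply_apply y
  have hfs : f.symm (f (π.proj y)) = π.proj y := f.symm_apply_apply _
  have h := fderiv_chart_comp (e'' := κ.total) (h := φ.symm) hy hy' φ.continuous.continuousAt
    (contDiffAt_totalRep φ.contMDiff.contMDiffAt hy hy')
    (contDiffAt_totalRep φ.symm.contMDiff.contMDiffAt hy' (by rwa [hs]))
  have hid : ⇑φ.symm ∘ ⇑φ = id := funext φ.symm_apply_apply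
  rw [hid, fderiv_chart_id hy] at h
  have h := congrArg (fun T => (T ((0 : Euc n), η)).2) h
  simp only [ContinuousLinearMap.comp_apply] at h
  rw [← inr_vertJacobian φ.contMDiff.contMDiffAt f.contMDiff.contMDiffAt hφ hy hy'] at h
  exact h

end BaseAndTotal

section LegendreCharts

variable [IsManifold 𝓘(ℝ, Euc n) ∞ X] [IsManifold 𝓘(ℝ, Euc n × Euc m) ∞ Y]
  {κ κ' : π.FibredChart}

/-- The canonical coordinates over a fibred chart, as a chart of the Legendre manifold. -/
def canonicalChart (κ : π.FibredChart) : OpenPartialHomeomorph π.Legendre (Canon n m) :=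
  (π.legendreCore.localTriv κ).toOpenPartialHomeomorph.trans
    (κ.total.prod (OpenPartialHomeomorph.refl (Euc m →L[ℝ] Euc n)))

theorem mem_canonicalChart_source {q : π.Legendre} :
    q ∈ (canonicalChart κ).source ↔ q.proj ∈ κ.total.source := by
  simp only [canonicalChart, OpenPartialHomeomorph.trans_source, Set.mem_inter_iff,
    OpenPartialHomeomorph.prod_source, Set.mem_preimage, Set.mem_prod,
    OpenPartialHomeomorph.refl_source, Set.mem_univ, and_true]
  exact ⟨fun h => h.1, fun h => ⟨h, h⟩⟩

theorem mem_canonicalChart_target {c : Canon n m} :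
    c ∈ (canonicalChart κ).target ↔ c.1 ∈ κ.total.target := by
  simp only [canonicalChart, OpenPartialHomeomorph.trans_target, Set.mem_inter_iff,
    OpenPartialHomeomorph.prod_target, Set.mem_preimage, Set.mem_prod,
    OpenPartialHomeomorph.refl_target, Set.mem_univ, and_true]
  exact ⟨fun h => h.1, fun h => ⟨h,
    ((π.legendreCore.mem_localTriv_target κ (κ.total.symm c.1, c.2)).2 (κ.total.map_target h) :)⟩⟩

theorem canonicalChart_symm_proj (c : Canon n m) :
    ((canonicalChart κ).symm c).proj = κ.total.symm c.1 := rfl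

theorem contMDiffAt_canonicalCoord {q : π.Legendre} (h : q.proj ∈ κ.total.source) :
    ContMDiffAt (modelLegendre n m) 𝓘(ℝ, Canon n m) ∞ (canonicalCoord κ) q := by
  have : MemTrivializationAtlas (π.legendreCore.localTriv κ) := ⟨⟨κ, rfl⟩⟩
  have h1 := ((π.legendreCore.localTriv κ).contMDiffOn (IB := 𝓘(ℝ, Euc n × Euc m))
    (n := ∞)).contMDiffAt
    ((π.legendreCore.localTriv κ).open_source.mem_nhds h)
  have h2 : ContMDiffAt (modelLegendre n m) 𝓘(ℝ, Euc n × Euc m) ∞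
     (fun q : π.Legendre => κ.total q.proj) q :=
    (contMDiffAt_total h).comp q (Bundle.contMDiffAt_proj _)
  exact h2.prodMk_space h1.snd

theorem contMDiffAt_canonicalChart_symm {q : π.Legendre} (h : q.proj ∈ κ.total.source) :
    ContMDiffAt 𝓘(ℝ, Canon n m) (modelLegendre n m) ∞ (canonicalChart κ).symm
      (canonicalCoord κ q) := by
  have : MemTrivializationAtlas (π.legendreCore.localTriv κ) := ⟨⟨κ, rfl⟩⟩
  have h1 := ((π.legendreCore.localTriv κ).contMDiffOn_symm (IB := 𝓘(ℝ, Euc n × Euc m))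
    (n := ∞)).contMDiffAt
    ((π.legendreCore.localTriv κ).open_target.mem_nhds
      ((π.legendreCore.localTriv κ).map_source h))
  have h2 : ContMDiffAt 𝓘(ℝ, Canon n m) (modelLegendre n m) ∞
      (fun c : Canon n m => (κ.total.symm c.1, c.2)) (canonicalCoord κ q) := by
    refine ContMDiffAt.prodMk ?_ contDiff_snd.contMDiff.contMDiffAt
    exact ContMDiffAt.comp (canonicalCoord κ q) (g := κ.total.symm) (contMDiffAt_total_symm h)
      contDiff_fst.contMDiff.contMDiffAt
  refine ContMDiffAt.comp (canonicalCoord κ q)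
    (g := (π.legendreCore.localTriv κ).toOpenPartialHomeomorph.symm) ?_ h2
  have : (fun c : Canon n m => (κ.total.symm c.1, c.2)) (canonicalCoord κ q) =
    (π.legendreCore.localTriv κ) q := Prod.ext (κ.total.left_inv h) rfl
  have h3 : (κ.total.prod (OpenPartialHomeomorph.refl (Euc m →L[ℝ] Euc n))).symm
      (canonicalCoord κ q) = (π.legendreCore.localTriv κ) q := this
  change ContMDiffAt _ _ _ _ ((κ.total.prod (OpenPartialHomeomorph.refl (Euc m →L[ℝ] Euc n))).symm
      (canonicalCoord κ q))
  rw [h3]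
  exact h1

end LegendreCharts

end

/-! ### Preservation of the multisymplectic form in canonical coordinates -/

section

variable {n m : ℕ} {X Y : Type*}
  [TopologicalSpace X] [ChartedSpace (Euc n) X]
  [TopologicalSpace Y] [ChartedSpace (Euc n × Euc m) Y]
  [IsManifold 𝓘(ℝ, Euc n) ∞ X] [IsManifold 𝓘(ℝ, Euc n × Euc m) ∞ Y]
  {π : FibredManifold n m X Y} {κ κ' : π.FibredChart}

/-- The representative of a map of the Legendre manifold in the canonical coordinates over two
fibred charts. -/
def canonicalRep (κ κ' : π.FibredChart) (Φ : π.Legendre → π.Legendre) : Canon n m → Canon n m :=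
  canonicalCoord κ' ∘ Φ ∘ (canonicalChart κ).symm

theorem contDiffAt_canonicalRep {Φ : π.Legendre → π.Legendre} {q : π.Legendre}
    (hΦ : ContMDiffAt (modelLegendre n m) (modelLegendre n m) ∞ Φ q)
    (hq : q.proj ∈ κ.total.source) (hq' : (Φ q).proj ∈ κ'.total.source) :
    ContDiffAt ℝ ∞ (canonicalRep κ κ' Φ) (canonicalCoord κ q) :=
  contDiffAt_chart_comp (e := canonicalChart κ) (e' := canonicalChart κ')
    (mem_canonicalChart_source.2 hq) (contMDiffAt_canonicalChart_symm hq) hΦ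
    (contMDiffAt_canonicalCoord hq')

theorem eventually_canonicalChart_symm_mem {Φ : π.Legendre → π.Legendre} {q : π.Legendre}
    (hΦ : ContinuousAt Φ q) (hq : q.proj ∈ κ.total.source) (hq' : (Φ q).proj ∈ κ'.total.source) :
    ∀ᶠ c in nhds (canonicalCoord κ q), c.1 ∈ κ.total.target ∧
      (Φ ((canonicalChart κ).symm c)).proj ∈ κ'.total.source := by
  have hs := mem_canonicalChart_source.2 hq
  have hc := (canonicalChart κ).continuousAt_symm ((canonicalChart κ).map_source hs)
  rw [← (canonicalChart κ).left_inv hs] at hΦ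
  have hm : (canonicalChart κ').source ∈
      nhds (Φ ((canonicalChart κ).symm (canonicalChart κ q))) := by
    rw [(canonicalChart κ).left_inv hs]
    exact (canonicalChart κ').open_source.mem_nhds (mem_canonicalChart_source.2 hq')
  filter_upwards [(hΦ.comp hc) hm, (canonicalChart κ).open_target.mem_nhds
    ((canonicalChart κ).map_source hs)] with c h1 h2
  exact ⟨mem_canonicalChart_target.1 h2, mem_canonicalChart_source.1 h1⟩

theorem fderiv_canonicalRep_fst_fst {Φ : π.Legendre → π.Legendre} {f : X → X} {q : π.Legendre}
    (hΦ : ContMDiffAt (modelLegendre n m) (modelLegendre n m) ∞ Φ q)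
    (hf : ContMDiffAt 𝓘(ℝ, Euc n) 𝓘(ℝ, Euc n) ∞ f (π.proj q.proj))
    (hΦf : ∀ q, π.proj (Φ q).proj = f (π.proj q.proj))
    (hq : q.proj ∈ κ.total.source) (hq' : (Φ q).proj ∈ κ'.total.source) (u : Canon n m) :
    (fderiv ℝ (canonicalRep κ κ' Φ) (canonicalCoord κ q) u).1.1 =
      baseJacobian κ κ' f (π.proj q.proj) u.1.1 := by
  let fst2 : Canon n m →L[ℝ] Euc n := ContinuousLinearMap.fst ℝ (Euc n) (Euc m) ∘L
    ContinuousLinearMap.fst ℝ (Euc n × Euc m) (Euc m →L[ℝ] Euc n)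
  have h1 := ((contDiffAt_canonicalRep hΦ hq hq').differentiableAt (by simp)).hasFDerivAt
  have h2 := fst2.hasFDerivAt.comp _ h1
  have hb := ((contDiffAt_baseRep hf (κ.proj_mem _ hq)
    (κ' := κ') (by rw [← hΦf]; exact κ'.proj_mem _ hq')).differentiableAt (by simp)).hasFDerivAt
  have hbase : fst2 (canonicalCoord κ q) = κ.base (π.proj q.proj) := κ.fst_total _ hq
  rw [← hbase] at hb
  have h3 := hb.comp (canonicalCoord κ q) fst2.hasFDerivAt
  have heq : fst2 ∘ canonicalRep κ κ' Φ =ᶠ[nhds (canonicalCoord κ q)]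
      (κ'.base ∘ f ∘ κ.base.symm) ∘ fst2 := by
    filter_upwards [eventually_canonicalChart_symm_mem hΦ.continuousAt hq hq'] with c hc
    obtain ⟨hct, hcs⟩ := hc
    have hs := κ.total.map_target hct
    have e1 := κ'.fst_total _ hcs
    have e2 := κ.fst_total _ hs
    rw [κ.total.right_inv hct] at e2
    change (κ'.total (Φ ((canonicalChart κ).symm c)).proj).1 = κ'.base (f (κ.base.symm c.1.1))
    rw [e1, hΦf, canonicalChart_symm_proj, e2, κ.base.left_inv (κ.proj_mem _ hs)]
  have := (h3.congr_of_eventuallyEq heq).unique h2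
  have := congrArg (fun T => T u) this
  rw [hbase] at this
  exact this.symm

/-- A diffeomorphism over the base preserves the multisymplectic form at a point if and only if
its representative rescales the pairing of vertical vectors by `(det A)⁻¹ A`, where `A` is the
Jacobian on the base. -/
theorem multisymplecticForm_map_eq_iff
    (Φ : π.Legendre ≃ₘ⟮modelLegendre n m, modelLegendre n m⟯ π.Legendre)
    (f : X ≃ₘ⟮𝓘(ℝ, Euc n), 𝓘(ℝ, Euc n)⟯ X)
    (hΦf : ∀ q, π.proj (Φ q).proj = f (π.proj q.proj)) {q : π.Legendre}
    (hq : q.proj ∈ κ.total.source) (hq' : (Φ q).proj ∈ κ'.total.source) :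
    (∀ u : Fin (n + 2) → TangentSpace (modelLegendre n m) q,
        multisymplecticForm κ' (Φ q)
            (fun a => mfderiv (modelLegendre n m) (modelLegendre n m) Φ q (u a)) =
          mfderiv 𝓘(ℝ, Euc n) 𝓘(ℝ, Euc n) f (π.proj q.proj) (multisymplecticForm κ q u)) ↔
    ∀ u v : Canon n m, u.1.1 = 0 → v.1.1 = 0 →
      (baseJacobian κ κ' f (π.proj q.proj)).det •
        momentumPairing (fderiv ℝ (canonicalRep κ κ' Φ) (canonicalCoord κ q) u)
          (fderiv ℝ (canonicalRep κ κ' Φ) (canonicalCoord κ q) v) =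
        baseJacobian κ κ' f (π.proj q.proj) (momentumPairing u v) := by
  have hΦq := Φ.contMDiff.contMDiffAt (x := q)
  have hfq := f.contMDiff.contMDiffAt (x := π.proj q.proj)
  have hx := κ.proj_mem _ hq
  have hx' : f (π.proj q.proj) ∈ κ'.base.source := by rw [← hΦf]; exact κ'.proj_mem _ hq'
  rw [← omegaModel_map_eq_iff (fderiv_canonicalRep_fst_fst hΦq hfq hΦf hq hq')]
  set L := fderiv ℝ (canonicalRep κ κ' Φ) (canonicalCoord κ q) with hL
  set A := baseJacobian κ κ' f (π.proj q.proj) with hA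
  let S : Euc n →L[ℝ] Euc n := mfderiv 𝓘(ℝ, Euc n) 𝓘(ℝ, Euc n) κ'.base.symm
    (κ'.base (f (π.proj q.proj)))
  let C : TangentSpace (modelLegendre n m) q →L[ℝ] Canon n m :=
    mfderiv (modelLegendre n m) 𝓘(ℝ, Canon n m) (canonicalCoord κ) q
  have hS : Function.Injective S := by
    refine Function.LeftInverse.injective (g := fun ξ => mfderiv 𝓘(ℝ, Euc n) 𝓘(ℝ, Euc n) κ'.base
      (f (π.proj q.proj)) ξ) fun ξ => ?_
    exact mfderiv_chart_symm_apply hx' (contMDiffAt_base hx') (contMDiffAt_base_symm hx') ξ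
  have hC : Function.Surjective C := by
    intro ξ
    exact ⟨_, mfderiv_chart_symm_apply (e := canonicalChart κ) (mem_canonicalChart_source.2 hq)
      (contMDiffAt_canonicalCoord hq) (contMDiffAt_canonicalChart_symm hq) ξ⟩
  have hleft : ∀ u : Fin (n + 2) → TangentSpace (modelLegendre n m) q,
      (multisymplecticForm κ' (Φ q)
        (fun a => mfderiv (modelLegendre n m) (modelLegendre n m) Φ q (u a)) : Euc n) =
        S (omegaModel n m (fun a => L (C (u a)))) := by
    intro u
    have h1 : ∀ a, (mfderiv (modelLegendre n m) 𝓘(ℝ, Canon n m) (canonicalCoord κ') (Φ q)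
        (mfderiv (modelLegendre n m) (modelLegendre n m) Φ q (u a)) : Canon n m) = L (C (u a)) :=
      fun a => mfderiv_chart_comp (e := canonicalChart κ) (e' := canonicalChart κ')
        (mem_canonicalChart_source.2 hq) (contMDiffAt_canonicalCoord hq) hΦq
        (contMDiffAt_canonicalCoord hq') (contDiffAt_canonicalRep hΦq hq hq') (u a)
    have h2 : (mfderiv 𝓘(ℝ, Euc n) 𝓘(ℝ, Euc n) κ'.base.symm (κ'.base (π.proj (Φ q).proj)) :
        Euc n →L[ℝ] Euc n) = S := by
      rw [hΦf]
    change (mfderiv 𝓘(ℝ, Euc n) 𝓘(ℝ, Euc n) κ'.base.symm (κ'.base (π.proj (Φ q).proj)) :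
        Euc n →L[ℝ] Euc n) (omegaModel n m (fun a =>
          (mfderiv (modelLegendre n m) 𝓘(ℝ, Canon n m) (canonicalCoord κ') (Φ q)
        (mfderiv (modelLegendre n m) (modelLegendre n m) Φ q (u a)) : Canon n m))) = _
    rw [h2]
    simp only [h1]
    rfl
  have hright : ∀ u : Fin (n + 2) → TangentSpace (modelLegendre n m) q,
      (mfderiv 𝓘(ℝ, Euc n) 𝓘(ℝ, Euc n) f (π.proj q.proj) (multisymplecticForm κ q u) : Euc n) =
        S (A (omegaModel n m (fun a => C (u a)))) := fun u =>
    mfderiv_comp_chart_symm hx hx' (contMDiffAt_base_symm hx) hfq (contMDiffAt_base_symm hx')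
      (contDiffAt_baseRep hfq hx hx') _
  constructor
  · intro h u
    choose v hv using fun a => hC (u a)
    have := h v
    have := (hleft v).symm.trans (this.trans (hright v))
    simp only [hv] at this
    exact hS this
  · intro h u
    exact (hleft u).trans ((congrArg S (h fun a => C (u a))).trans (hright u).symm)

end

/-! ### Isomorphisms and the group of multisymplectic diffeomorphisms -/

section

variable {n m : ℕ}

set_option maxHeartbeats 1000000 in
/-- A map of the form `y' = φ(x, y)`, `p'^λ_i = J (∂y^j/∂y'^i) (∂x'^λ/∂x^μ) p^μ_j` rescales the
pairing of vertical vectors by `(det A)⁻¹ A`. Here `ψ` is the inverse of `φ`; the terms with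
derivatives of the coefficients cancel because the second derivative of `ψ` is symmetric. -/
theorem momentumPairing_map_of_momentumTransform {A : Euc n →L[ℝ] Euc n} (hA : A.det ≠ 0)
    {F : Canon n m → Canon n m} {L : Canon n m →L[ℝ] Canon n m}
    {φ ψ : Euc n × Euc m → Euc n × Euc m} {φ' : (Euc n × Euc m) →L[ℝ] (Euc n × Euc m)}
    {c : Canon n m} (hF : HasFDerivAt F L c) (hφ : HasFDerivAt φ φ' c.1)
    (hψ : ContDiffAt ℝ ∞ ψ (φ c.1))
    (heq : ∀ᶠ d in nhds c, d.1.1 = c.1.1 → F d = (φ d.1, momentumTransform A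
      (ContinuousLinearMap.snd ℝ (Euc n) (Euc m) ∘L fderiv ℝ ψ (φ d.1) ∘L
        ContinuousLinearMap.inr ℝ (Euc n) (Euc m)) d.2))
    (hvert : ∀ η, (φ' (0, η)).1 = 0)
    (hinv : ∀ η, (fderiv ℝ ψ (φ c.1) (φ' (0, η))).2 = η)
    {u v : Canon n m} (hu : u.1.1 = 0) (hv : v.1.1 = 0) :
    A.det • momentumPairing (L u) (L v) = A (momentumPairing u v) := by
  set D2 := fderiv ℝ (fderiv ℝ ψ) (φ c.1) with hD2
  have hsymm : ∀ a b, D2 a b = D2 b a := hψ.isSymmSndFDerivAt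
    (by
      rw [minSmoothness_of_isRCLikeNormedField]
      exact WithTop.coe_le_coe.2 le_top)
  -- Restrict to the fibre over the base point, on which `A` is constant.
  let j : (Euc m × (Euc m →L[ℝ] Euc n)) →L[ℝ] Canon n m :=
    ((ContinuousLinearMap.inr ℝ (Euc n) (Euc m)) ∘L ContinuousLinearMap.fst ℝ _ _).prod
      (ContinuousLinearMap.snd ℝ _ _)
  let J : (Euc m × (Euc m →L[ℝ] Euc n)) → Canon n m := fun w => ((c.1.1, w.1), w.2)
  let w₀ : Euc m × (Euc m →L[ℝ] Euc n) := (c.1.2, c.2)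
  have hJ : HasFDerivAt J j w₀ := by
    have := (hasFDerivAt_const ((c.1.1, 0), 0) w₀).add j.hasFDerivAt
    rw [zero_add] at this
    refine this.congr_of_eventuallyEq (Filter.Eventually.of_forall fun w => ?_)
    refine Prod.ext (Prod.ext ?_ ?_) ?_ <;> simp [J, j]
  have hFJ : HasFDerivAt (F ∘ J) (L ∘L j) w₀ := HasFDerivAt.comp w₀ (g := F) hF hJ
  let T : ((Euc n × Euc m) →L[ℝ] (Euc n × Euc m)) →L[ℝ] (Euc m →L[ℝ] Euc m) :=
    (ContinuousLinearMap.compL ℝ (Euc m) (Euc n × Euc m) (Euc m)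
      (ContinuousLinearMap.snd ℝ (Euc n) (Euc m))) ∘L
      ((ContinuousLinearMap.compL ℝ (Euc m) (Euc n × Euc m) (Euc n × Euc m)).flip
        (ContinuousLinearMap.inr ℝ (Euc n) (Euc m)))
  let j₁ := (ContinuousLinearMap.fst ℝ (Euc n × Euc m) (Euc m →L[ℝ] Euc n)) ∘L j
  have hJ₁ : HasFDerivAt (fun w => (J w).1) j₁ w₀ := hJ.fst
  have hφJ : HasFDerivAt (fun w => φ (J w).1) (φ' ∘L j₁) w₀ :=
    HasFDerivAt.comp w₀ (g := φ) (f := fun w => (J w).1) hφ hJ₁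
  have hψ' : HasFDerivAt (fderiv ℝ ψ) D2 (φ c.1) :=
    ((hψ.fderiv_right (m := ∞) (by simp)).differentiableAt (by simp)).hasFDerivAt
  have hψJ : HasFDerivAt (fun w => T (fderiv ℝ ψ (φ (J w).1))) (T ∘L D2 ∘L φ' ∘L j₁) w₀ :=
    T.hasFDerivAt.comp w₀ (HasFDerivAt.comp w₀ (g := fderiv ℝ ψ) (f := fun w => φ (J w).1) hψ' hφJ)
  have hcomp := (hasFDerivAt_snd (𝕜 := ℝ) (p := w₀)).clm_comp hψJ
  have hmom := (A.det⁻¹ • ContinuousLinearMap.compL ℝ (Euc m) (Euc n) (Euc n) A).hasFDerivAt.comp w₀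
    hcomp
  have hall := hφJ.prodMk hmom
  have hev : F ∘ J =ᶠ[nhds w₀] fun w => (φ (J w).1,
      (A.det⁻¹ • ContinuousLinearMap.compL ℝ (Euc m) (Euc n) (Euc n) A)
        (w.2 ∘L T (fderiv ℝ ψ (φ (J w).1)))) := by
    filter_upwards [hJ.continuousAt.eventually heq] with w hw
    exact hw rfl
  have hLj := hFJ.unique (hall.congr_of_eventuallyEq hev)
  have hLy : ∀ w : Euc m × (Euc m →L[ℝ] Euc n), (L (j w)).1.2 = (φ' (0, w.1)).2 := by
    intro w
    exact congrArg (fun S => (S w).1.2) hLj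
  have hLp : ∀ (w : Euc m × (Euc m →L[ℝ] Euc n)) (η : Euc m), (L (j w)).2 (φ' (0, η)).2 =
      A.det⁻¹ • (A (w.2 η) + A (c.2 (D2 (φ' (0, w.1)) (φ' (0, η))).2)) := by
    intro w η
    have h1 : (0, (φ' (0, η)).2) = φ' (0, η) := Prod.ext (hvert η).symm rfl
    have h2 := congrArg (fun S => (S w).2 (φ' (0, η)).2) hLj
    refine h2.trans ?_
    change A.det⁻¹ • A (c.2 (D2 (φ' (0, w.1)) (0, (φ' (0, η)).2)).2 +
      w.2 (fderiv ℝ ψ (φ c.1) (0, (φ' (0, η)).2)).2) = _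
    rw [h1, hinv, map_add, add_comm]
  have hju : j (u.1.2, u.2) = u := Prod.ext (Prod.ext hu.symm rfl) rfl
  have hjv : j (v.1.2, v.2) = v := Prod.ext (Prod.ext hv.symm rfl) rfl
  have a1 := hLp (u.1.2, u.2) v.1.2
  have a2 := hLp (v.1.2, v.2) u.1.2
  have b1 := hLy (u.1.2, u.2)
  have b2 := hLy (v.1.2, v.2)
  rw [hju] at a1 b1
  rw [hjv] at a2 b2
  dsimp only at a1 a2 b1 b2
  rw [momentumPairing, b1, b2, a1, a2, hsymm (φ' (0, v.1.2)), ← smul_sub, smul_smul,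
    mul_inv_cancel₀ hA, one_smul, add_sub_add_right_eq_sub, momentumPairing, map_sub]

variable {X Y : Type*}
  [TopologicalSpace X] [ChartedSpace (Euc n) X]
  [TopologicalSpace Y] [ChartedSpace (Euc n × Euc m) Y]
  [IsManifold 𝓘(ℝ, Euc n) ∞ X] [IsManifold 𝓘(ℝ, Euc n × Euc m) ∞ Y]
  {π : FibredManifold n m X Y} {κ κ' : π.FibredChart}

/-- The isomorphisms of the Legendre manifold are multisymplectic. -/
theorem IsLegendreIso.isMultisymplectic
    {G : π.Legendre ≃ₘ⟮modelLegendre n m, modelLegendre n m⟯ π.Legendre} (hG : IsLegendreIso G) :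
    IsMultisymplectic G := by
  obtain ⟨φ, f, hφf, hGφ, hmom⟩ := hG
  have hGf : ∀ q, π.proj (G q).proj = f (π.proj q.proj) := fun q => by rw [hGφ, hφf]
  refine ⟨f, hGf, fun q κ κ' hq hq' => ?_⟩
  refine (multisymplecticForm_map_eq_iff G f hGf hq hq').2 fun u v hu hv => ?_
  have hqφ : φ q.proj ∈ κ'.total.source := by rwa [← hGφ]
  have hGq := G.contMDiff.contMDiffAt (x := q)
  have hfx' : f (π.proj q.proj) ∈ κ'.base.source := by rw [← hφf]; exact κ'.proj_mem _ hqφ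
  have hs : φ.symm (φ q.proj) = q.proj := φ.symm_apply_apply _
  have hφl : (κ'.total ∘ φ ∘ κ.total.symm) (canonicalCoord κ q).1 = κ'.total (φ q.proj) := by
    simp [canonicalCoord, κ.total.left_inv hq]
  refine momentumPairing_map_of_momentumTransform
    (det_baseJacobian_ne_zero_of_diffeomorph f (κ.proj_mem _ hq) hfx')
    (φ := κ'.total ∘ φ ∘ κ.total.symm) (ψ := κ.total ∘ φ.symm ∘ κ'.total.symm)
    ((contDiffAt_canonicalRep hGq hq hq').differentiableAt (by simp)).hasFDerivAt
    ((contDiffAt_totalRep φ.contMDiff.contMDiffAt hq hqφ).differentiableAt (by simp)).hasFDerivAt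
    ?_ ?_ ?_ ?_ hu hv
  · rw [hφl]
    exact contDiffAt_totalRep φ.symm.contMDiff.contMDiffAt hqφ (by rwa [hs])
  · filter_upwards [eventually_canonicalChart_symm_mem G.continuous.continuousAt hq hq']
      with d hd hx
    obtain ⟨hdt, hds⟩ := hd
    have hdq := κ.total.map_target hdt
    have h1 := hmom ((canonicalChart κ).symm d) κ κ' hdq (by rwa [← hGφ])
    have h2 : canonicalCoord κ ((canonicalChart κ).symm d) = d :=
      (canonicalChart κ).right_inv (mem_canonicalChart_target.2 hdt)
    have h3 : κ.base (π.proj (κ.total.symm d.1)) = κ.base (π.proj q.proj) := by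
      rw [← κ.fst_total _ hdq, κ.total.right_inv hdt, hx, ← κ.fst_total _ hq]
      rfl
    rw [h2] at h1
    refine Prod.ext ?_ ?_
    · change κ'.total (G ((canonicalChart κ).symm d)).proj = κ'.total (φ (κ.total.symm d.1))
      rw [hGφ, canonicalChart_symm_proj]
    · refine h1.trans ?_
      rw [canonicalChart_symm_proj, baseJacobian, h3]
      rfl
  · intro η
    exact (congrArg Prod.fst (inr_vertJacobian φ.contMDiff.contMDiffAt f.contMDiff.contMDiffAt
      hφf hq hqφ η)).symm
  · intro η
    rw [hφl]
    refine Eq.trans ?_ (vertJacobian_symm_apply φ f hφf hq hqφ η)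
    have := inr_vertJacobian φ.contMDiff.contMDiffAt f.contMDiff.contMDiffAt hφf hq hqφ η
    exact congrArg
      (fun ξ => (fderiv ℝ (κ.total ∘ φ.symm ∘ κ'.total.symm) (κ'.total (φ q.proj)) ξ).2) this.symm

/-- The identity is an isomorphism: this is the transformation law of the momenta under a change
of fibred coordinates. -/
theorem isLegendreIso_refl :
    IsLegendreIso (Diffeomorph.refl (modelLegendre n m) π.Legendre ∞) := by
  refine ⟨Diffeomorph.refl _ _ _, Diffeomorph.refl _ _ _, fun _ => rfl, fun _ => rfl, ?_⟩
  intro q κ κ' hq hq'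
  exact (π.legendreCore.coordChange_comp (π.legendreCore.indexAt q.proj) κ κ' q.proj
    ⟨⟨π.legendreCore.mem_baseSet_at _, hq⟩, hq'⟩ q.snd).symm

/-- The value of the multisymplectic form does not depend on the fibred coordinates. -/
theorem multisymplecticForm_eq {q : π.Legendre} (hq : q.proj ∈ κ.total.source)
    (hq' : q.proj ∈ κ'.total.source) : multisymplecticForm κ q = multisymplecticForm κ' q := by
  obtain ⟨f, hf, h⟩ := (isLegendreIso_refl (π := π)).isMultisymplectic
  have hfid : ⇑f = id := by
    funext x
    obtain ⟨y, rfl⟩ := π.surjective x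
    exact (hf ⟨y, 0⟩).symm
  ext u
  have h1 := h q κ κ' hq hq' u
  rw [hfid, mfderiv_id] at h1
  have h2 : mfderiv (modelLegendre n m) (modelLegendre n m)
      (Diffeomorph.refl (modelLegendre n m) π.Legendre ∞) q = ContinuousLinearMap.id ℝ _ :=
    mfderiv_id
  rw [h2] at h1
  exact h1.symm

/-- The inverse of a multisymplectic diffeomorphism is multisymplectic: in canonical coordinates the
relation `det A • ⟨L u, L v⟩ = A ⟨u, v⟩` is solved for the pairing of the preimages. -/
theorem IsMultisymplectic.symm
    {Φ : π.Legendre ≃ₘ⟮modelLegendre n m, modelLegendre n m⟯ π.Legendre}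
    (hΦ : IsMultisymplectic Φ) : IsMultisymplectic Φ.symm := by
  obtain ⟨f, hf, h⟩ := hΦ
  have hf' : ∀ q, π.proj (Φ.symm q).proj = f.symm (π.proj q.proj) := by
    intro q
    rw [← f.symm_apply_apply (π.proj (Φ.symm q).proj), ← hf, Φ.apply_symm_apply]
  refine ⟨f.symm, hf', fun q κ κ' hq hq' => ?_⟩
  refine (multisymplecticForm_map_eq_iff Φ.symm f.symm hf' hq hq').2 fun u v hu hv => ?_
  have hqq : Φ (Φ.symm q) = q := Φ.apply_symm_apply q
  have hq2 : (Φ (Φ.symm q)).proj ∈ κ.total.source := by rwa [hqq]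
  have hx := κ.proj_mem _ hq
  have hx' : f.symm (π.proj q.proj) ∈ κ'.base.source := by rw [← hf']; exact κ'.proj_mem _ hq'
  have hxx : f (f.symm (π.proj q.proj)) = π.proj q.proj := f.apply_symm_apply _
  have hΦq := Φ.symm.contMDiff.contMDiffAt (x := q)
  have key := (multisymplecticForm_map_eq_iff Φ f hf hq' hq2).1 (h (Φ.symm q) κ' κ hq' hq2)
  have hL := fderiv_chart_comp (e := canonicalChart κ) (e' := canonicalChart κ')
    (e'' := canonicalChart κ) (g := Φ.symm) (h := Φ) (x := q)
    (mem_canonicalChart_source.2 hq) (mem_canonicalChart_source.2 hq')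
    Φ.symm.continuous.continuousAt
    (contDiffAt_canonicalRep hΦq hq hq')
    (contDiffAt_canonicalRep Φ.contMDiff.contMDiffAt hq' hq2)
  have hid : ⇑Φ ∘ ⇑Φ.symm = id := funext Φ.apply_symm_apply
  rw [hid, fderiv_chart_id (mem_canonicalChart_source.2 hq)] at hL
  have hA := fderiv_chart_comp (e := κ'.base) (e' := κ.base)
    (e'' := κ'.base) (g := f) (h := f.symm) (x := f.symm (π.proj q.proj))
    hx' (by rwa [hxx]) f.continuous.continuousAt
    (contDiffAt_baseRep f.contMDiff.contMDiffAt hx' (by rwa [hxx]))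
    (contDiffAt_baseRep f.symm.contMDiff.contMDiffAt (by rwa [hxx]) (by rwa [hxx]))
  have hidf : ⇑f.symm ∘ ⇑f = id := funext f.symm_apply_apply
  rw [hidf, fderiv_chart_id hx', hxx] at hA
  rw [hf'] at key
  change baseJacobian κ κ' f.symm (π.proj q.proj) ∘L
    baseJacobian κ' κ f (f.symm (π.proj q.proj)) = _ at hA
  change fderiv ℝ (canonicalRep κ' κ Φ) (canonicalCoord κ' (Φ.symm q)) ∘L
    fderiv ℝ (canonicalRep κ κ' Φ.symm) (canonicalCoord κ q) = _ at hL
  have hvert : ∀ u : Canon n m, u.1.1 = 0 →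
      (fderiv ℝ (canonicalRep κ κ' Φ.symm) (canonicalCoord κ q) u).1.1 = 0 := by
    intro u hu
    rw [fderiv_canonicalRep_fst_fst hΦq f.symm.contMDiff.contMDiffAt hf' hq hq', hu, map_zero]
  have := key _ _ (hvert u hu) (hvert v hv)
  have hL' : ∀ u, fderiv ℝ (canonicalRep κ' κ Φ) (canonicalCoord κ' (Φ.symm q))
      (fderiv ℝ (canonicalRep κ κ' Φ.symm) (canonicalCoord κ q) u) = u :=
    fun u => congrArg (fun T => T u) hL
  rw [hL', hL'] at this
  have hA' : ∀ ξ, baseJacobian κ κ' f.symm (π.proj q.proj)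
    (baseJacobian κ' κ f (f.symm (π.proj q.proj)) ξ) = ξ := fun ξ => congrArg (fun T => T ξ) hA
  have h3 := congrArg (baseJacobian κ κ' f.symm (π.proj q.proj)) this
  rw [hA', map_smul] at h3
  have hdet := congrArg ContinuousLinearMap.det hA
  simp only [ContinuousLinearMap.det, ContinuousLinearMap.toLinearMap_comp,
    LinearMap.det_comp, ContinuousLinearMap.coe_id, LinearMap.det_id] at hdet
  rw [← h3, smul_smul]
  simp only [ContinuousLinearMap.det]
  rw [hdet, one_smul]

theorem IsMultisymplectic.trans
    {Φ Ψ : π.Legendre ≃ₘ⟮modelLegendre n m, modelLegendre n m⟯ π.Legendre}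
    (hΦ : IsMultisymplectic Φ) (hΨ : IsMultisymplectic Ψ) : IsMultisymplectic (Φ.trans Ψ) := by
  obtain ⟨f, hf, hΦ⟩ := hΦ
  obtain ⟨g, hg, hΨ⟩ := hΨ
  refine ⟨f.trans g, fun q => ?_, fun q κ κ'' hq hq'' u => ?_⟩
  · change π.proj (Ψ (Φ q)).proj = g (f (π.proj q.proj))
    rw [hg, hf]
  · obtain ⟨κ', hq'⟩ := π.exists_fibredChart (Φ q).proj
    have h1 := hΦ q κ κ' hq hq' u
    have h2 := hΨ (Φ q) κ' κ'' hq' hq''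
      (fun a => mfderiv (modelLegendre n m) (modelLegendre n m) Φ q (u a))
    have d1 := mfderiv_comp q (Ψ.contMDiff.contMDiffAt.mdifferentiableAt (by simp))
      (Φ.contMDiff.contMDiffAt.mdifferentiableAt (by simp))
    have d2 := mfderiv_comp (π.proj q.proj) (g.contMDiff.contMDiffAt.mdifferentiableAt (by simp))
      (f.contMDiff.contMDiffAt.mdifferentiableAt (by simp))
    have e1 : (mfderiv (modelLegendre n m) (modelLegendre n m) (Φ.trans Ψ) q) =
        mfderiv (modelLegendre n m) (modelLegendre n m) (Ψ ∘ Φ) q := rfl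
    have e2 : (mfderiv 𝓘(ℝ, Euc n) 𝓘(ℝ, Euc n) (f.trans g) (π.proj q.proj)) =
        mfderiv 𝓘(ℝ, Euc n) 𝓘(ℝ, Euc n) (g ∘ f) (π.proj q.proj) := rfl
    rw [e1, e2, d1, d2]
    have e3 : (mfderiv 𝓘(ℝ, Euc n) 𝓘(ℝ, Euc n) g (π.proj (Φ q).proj) : Euc n →L[ℝ] Euc n) =
        mfderiv 𝓘(ℝ, Euc n) 𝓘(ℝ, Euc n) g (f (π.proj q.proj)) := by rw [hf]
    refine h2.trans ?_
    refine (congrArg (mfderiv 𝓘(ℝ, Euc n) 𝓘(ℝ, Euc n) g (π.proj (Φ q).proj) :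
      Euc n →L[ℝ] Euc n) h1).trans ?_
    exact congrArg (fun T : Euc n →L[ℝ] Euc n => T (mfderiv 𝓘(ℝ, Euc n) 𝓘(ℝ, Euc n) f
      (π.proj q.proj) (multisymplecticForm κ q u) : Euc n)) e3

end

/-! ### Translations -/

section

variable {n m : ℕ} {X Y : Type*}
  [TopologicalSpace X] [ChartedSpace (Euc n) X]
  [TopologicalSpace Y] [ChartedSpace (Euc n × Euc m) Y]
  [IsManifold 𝓘(ℝ, Euc n) ∞ X] [IsManifold 𝓘(ℝ, Euc n × Euc m) ∞ Y]
  {π : FibredManifold n m X Y} {κ κ' : π.FibredChart}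

theorem canonicalCoord_snd_add (y : Y) (a b : π.legendreCore.Fiber y) :
    (canonicalCoord κ ⟨y, a + b⟩).2 = (canonicalCoord κ ⟨y, a⟩).2 + (canonicalCoord κ ⟨y, b⟩).2 :=
  map_add (π.legendreCore.coordChange (π.legendreCore.indexAt y) κ y) a b

theorem canonicalCoord_snd_zero (y : Y) :
    (canonicalCoord κ (⟨y, 0⟩ : π.Legendre)).2 = 0 :=
  map_zero (π.legendreCore.coordChange (π.legendreCore.indexAt y) κ y)

theorem canonicalCoord_snd_neg (y : Y) (a : π.legendreCore.Fiber y) :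
    (canonicalCoord κ ⟨y, -a⟩).2 = -(canonicalCoord κ ⟨y, a⟩).2 :=
  map_neg (π.legendreCore.coordChange (π.legendreCore.indexAt y) κ y) a

/-- Points of the Legendre bundle over the domain of a fibred chart are determined by their
canonical coordinates. -/
theorem canonicalCoord_injOn {q q' : π.Legendre} (hq : q.proj ∈ κ.total.source)
    (hq' : q'.proj ∈ κ.total.source) (h : canonicalCoord κ q = canonicalCoord κ q') : q = q' :=
  (canonicalChart κ).injOn (mem_canonicalChart_source.2 hq) (mem_canonicalChart_source.2 hq') h

theorem contMDiff_translation (r : LegendreSection π) :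
    ContMDiff (modelLegendre n m) (modelLegendre n m) ∞ (translation r) := by
  intro q
  obtain ⟨κ, hq⟩ := π.exists_fibredChart q.proj
  have : MemTrivializationAtlas (π.legendreCore.localTriv κ) := ⟨⟨κ, rfl⟩⟩
  refine ((π.legendreCore.localTriv κ).contMDiffAt_iff (n := ∞)
    (IB := 𝓘(ℝ, Euc n × Euc m)) (f := translation r) (x₀ := q) hq).2
    ⟨Bundle.contMDiffAt_proj _, ?_⟩
  have h1 := ((π.legendreCore.localTriv κ).contMDiffAt_iff
    (n := ∞) (IB := 𝓘(ℝ, Euc n × Euc m)) (f := id) (x₀ := q) hq).1 contMDiffAt_id |>.2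
  have h2 := ((π.legendreCore.localTriv κ).contMDiffAt_iff (n := ∞) (IB := 𝓘(ℝ, Euc n × Euc m))
    (f := fun q : π.Legendre => (⟨q.proj, r q.proj⟩ : π.Legendre)) (x₀ := q) hq).1
    ((r.contMDiff q.proj).comp q (Bundle.contMDiffAt_proj _)) |>.2
  refine (h1.add h2).congr_of_eventuallyEq (Filter.Eventually.of_forall fun q' => ?_)
  exact canonicalCoord_snd_add (κ := κ) q'.proj q'.snd (r q'.proj)

theorem translation_neg_translation (r : LegendreSection π) (q : π.Legendre) :
    translation (-r) (translation r q) = q :=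
  congrArg (fun v => (⟨q.proj, v⟩ : π.Legendre)) (add_neg_cancel_right q.snd (r q.proj))

theorem translation_translation_neg (r : LegendreSection π) (q : π.Legendre) :
    translation r (translation (-r) q) = q :=
  congrArg (fun v => (⟨q.proj, v⟩ : π.Legendre)) (neg_add_cancel_right q.snd (r q.proj))

/-- The translation by a section as a diffeomorphism of the Legendre manifold. -/
def translationDiffeomorph (r : LegendreSection π) :
    π.Legendre ≃ₘ⟮modelLegendre n m, modelLegendre n m⟯ π.Legendre where
  toFun := translation r
  invFun := translation (-r)
  left_inv := translation_neg_translation r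
  right_inv := translation_translation_neg r
  contMDiff_toFun := contMDiff_translation r
  contMDiff_invFun := contMDiff_translation (-r)

/-- The momentum components of a section, as a function of the fibred coordinates. -/
def sectionRep (r : LegendreSection π) (κ : π.FibredChart) (z : Euc n × Euc m) :
    Euc m →L[ℝ] Euc n :=
  (canonicalCoord κ ⟨κ.total.symm z, r (κ.total.symm z)⟩).2

theorem contDiffAt_sectionRep (r : LegendreSection π) {z : Euc n × Euc m}
    (hz : z ∈ κ.total.target) : ContDiffAt ℝ ∞ (sectionRep r κ) z := by
  have hs := κ.total.map_target hz
  rw [← contMDiffAt_iff_contDiffAt]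
  have h1 : ContMDiffAt (modelLegendre n m) 𝓘(ℝ, Canon n m) ∞ (canonicalCoord κ)
      ⟨κ.total.symm z, r (κ.total.symm z)⟩ := contMDiffAt_canonicalCoord hs
  have h2 : ContMDiffAt 𝓘(ℝ, Euc n × Euc m) 𝓘(ℝ, Euc n × Euc m) ∞ κ.total.symm z :=
    contMDiffAt_symm_of_mem_maximalAtlas κ.total_mem hz
  have h3 := ContMDiffAt.comp z (g := fun y => (⟨y, r y⟩ : π.Legendre)) (r.contMDiff _) h2
  have h4 := ContMDiffAt.comp z (g := canonicalCoord κ) h1 h3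
  exact contDiff_snd.contMDiff.contMDiffAt.comp z h4

/-- The symmetry `∂_j r^λ_i = ∂_i r^λ_j` in all fibred coordinates, without bases. -/
def HasSymmetricDerivative (r : LegendreSection π) : Prop :=
  ∀ (κ : π.FibredChart), ∀ z ∈ κ.total.target, ∀ η η' : Euc m,
    fderiv ℝ (sectionRep r κ) z (0, η) η' = fderiv ℝ (sectionRep r κ) z (0, η') η

/-- In one fibred chart `τ_r` is `p' = p + r(x, y)`, which changes the pairing of vertical vectors
by the skew-symmetric part of the vertical derivative of `r`. -/
theorem translation_preserves_iff (r : LegendreSection π) {q : π.Legendre}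
    (hq : q.proj ∈ κ.total.source) :
    (∀ u : Fin (n + 2) → TangentSpace (modelLegendre n m) q,
        multisymplecticForm κ (translationDiffeomorph r q)
            (fun a => mfderiv (modelLegendre n m) (modelLegendre n m)
              (translationDiffeomorph r) q (u a)) =
          mfderiv 𝓘(ℝ, Euc n) 𝓘(ℝ, Euc n) (Diffeomorph.refl 𝓘(ℝ, Euc n) X ∞) (π.proj q.proj)
            (multisymplecticForm κ q u)) ↔
      ∀ η η' : Euc m, fderiv ℝ (sectionRep r κ) (κ.total q.proj) (0, η) η' =
        fderiv ℝ (sectionRep r κ) (κ.total q.proj) (0, η') η := by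
  rw [multisymplecticForm_map_eq_iff (translationDiffeomorph r) (Diffeomorph.refl 𝓘(ℝ, Euc n) X ∞)
    (fun _ => rfl) hq hq]
  set L := fderiv ℝ (canonicalRep κ κ (translationDiffeomorph r)) (canonicalCoord κ q) with hL
  set R := fderiv ℝ (sectionRep r κ) (κ.total q.proj) with hR
  have hA : baseJacobian κ κ (Diffeomorph.refl 𝓘(ℝ, Euc n) X ∞) (π.proj q.proj) =
      ContinuousLinearMap.id ℝ (Euc n) := baseJacobian_self (κ.proj_mem _ hq)
  have hLR : ∀ u, L u = (u.1, u.2 + R u.1) := by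
    have h1 : HasFDerivAt (sectionRep r κ) R (canonicalCoord κ q).1 :=
      ((contDiffAt_sectionRep r (κ.total.map_source hq)).differentiableAt (by simp)).hasFDerivAt
    have h2 := HasFDerivAt.comp (canonicalCoord κ q) (g := sectionRep r κ) h1 hasFDerivAt_fst
    have h3 := (hasFDerivAt_fst (𝕜 := ℝ) (p := canonicalCoord κ q)).prodMk
      ((hasFDerivAt_snd (𝕜 := ℝ) (p := canonicalCoord κ q)).add h2)
    have heq : canonicalRep κ κ (translationDiffeomorph r) =ᶠ[nhds (canonicalCoord κ q)]
        fun c => (c.1, c.2 + sectionRep r κ c.1) := by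
      filter_upwards [(canonicalChart κ).open_target.mem_nhds
        ((canonicalChart κ).map_source (mem_canonicalChart_source.2 hq))] with c hc
      have h4 := (canonicalChart κ).right_inv hc
      have h5 : κ.total (κ.total.symm c.1) = c.1 := congrArg Prod.fst h4
      refine Prod.ext h5 ?_
      refine (canonicalCoord_snd_add (κ := κ) _ _ _).trans ?_
      exact congrArg₂ (· + ·) (congrArg Prod.snd h4) rfl
    have h5 := (h3.congr_of_eventuallyEq heq).fderiv
    intro u
    rw [hL, h5]
    rfl
  rw [hA]
  have hdet : (ContinuousLinearMap.id ℝ (Euc n)).det = 1 := by simp [ContinuousLinearMap.det]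
  constructor
  · intro h η η'
    have := h ((0, η), 0) ((0, η'), 0) rfl rfl
    rw [hdet, hLR, hLR] at this
    simpa [momentumPairing, sub_eq_zero] using this
  · rintro h ⟨⟨ξ, η⟩, p⟩ ⟨⟨ξ', η'⟩, p'⟩ hu hv
    dsimp only at hu hv
    subst hu hv
    rw [hdet, hLR, hLR]
    simp [momentumPairing, h η η']

/-- The translation by `r` is multisymplectic if and only if `∂_j r^λ_i = ∂_i r^λ_j` in all fibred
coordinates. -/
theorem isMultisymplectic_translation_iff (r : LegendreSection π) :
    IsMultisymplectic (translationDiffeomorph r) ↔ HasSymmetricDerivative r := by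
  constructor
  · rintro ⟨f, hf, h⟩ κ z hz
    have hfid : f = Diffeomorph.refl 𝓘(ℝ, Euc n) X ∞ := by
      ext x
      obtain ⟨y, rfl⟩ := π.surjective x
      exact (hf ⟨y, 0⟩).symm
    subst hfid
    have hs := κ.total.map_target hz
    have := (translation_preserves_iff (κ := κ) r (q := ⟨κ.total.symm z, 0⟩) hs).1
      (h _ κ κ hs hs)
    rwa [κ.total.right_inv hz] at this
  · intro h
    refine ⟨Diffeomorph.refl 𝓘(ℝ, Euc n) X ∞, fun q => rfl, fun q κ κ' hq hq' u => ?_⟩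
    have hq'' : (translationDiffeomorph r q).proj ∈ κ.total.source := hq
    rw [multisymplecticForm_eq hq' hq'']
    exact (translation_preserves_iff (κ := κ) r hq).2 (h κ _ (κ.total.map_source hq)) u

end

/-! ### The structure of a multisymplectic diffeomorphism -/

section

variable {n m : ℕ} {X Y : Type*}
  [TopologicalSpace X] [ChartedSpace (Euc n) X]
  [TopologicalSpace Y] [ChartedSpace (Euc n × Euc m) Y]
  [IsManifold 𝓘(ℝ, Euc n) ∞ X] [IsManifold 𝓘(ℝ, Euc n × Euc m) ∞ Y]
  {π : FibredManifold n m X Y} {κ κ' : π.FibredChart}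

theorem contMDiff_legendreProj : ContMDiff (modelLegendre n m) 𝓘(ℝ, Euc n × Euc m) ∞
    (fun q : π.Legendre => q.proj) :=
  Bundle.contMDiff_proj (F := Euc m →L[ℝ] Euc n) (IB := 𝓘(ℝ, Euc n × Euc m)) π.legendreCore.Fiber

theorem contMDiff_legendreZero : ContMDiff 𝓘(ℝ, Euc n × Euc m) (modelLegendre n m) ∞
    (fun y : Y => (⟨y, 0⟩ : π.Legendre)) :=
  Bundle.contMDiff_zeroSection (F := Euc m →L[ℝ] Euc n) (IB := 𝓘(ℝ, Euc n × Euc m)) ℝ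
    π.legendreCore.Fiber

/-- The fibre of the Legendre bundle over a point, parametrized by the momenta in a fibred
chart. -/
def fibrePoint (κ : π.FibredChart) (y : Y) (p : Euc m →L[ℝ] Euc n) : π.Legendre :=
  (canonicalChart κ).symm (κ.total y, p)

theorem fibrePoint_proj {y : Y} (hy : y ∈ κ.total.source) (p : Euc m →L[ℝ] Euc n) :
    (fibrePoint κ y p).proj = y :=
  κ.total.left_inv hy

theorem canonicalCoord_fibrePoint {y : Y} (hy : y ∈ κ.total.source) (p : Euc m →L[ℝ] Euc n) :
    canonicalCoord κ (fibrePoint κ y p) = (κ.total y, p) :=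
  (canonicalChart κ).right_inv (mem_canonicalChart_target.2 (κ.total.map_source hy))

theorem fibrePoint_canonicalCoord {q : π.Legendre} (hq : q.proj ∈ κ.total.source) :
    fibrePoint κ q.proj (canonicalCoord κ q).2 = q :=
  (canonicalChart κ).left_inv (mem_canonicalChart_source.2 hq)

theorem continuous_fibrePoint {y : Y} (hy : y ∈ κ.total.source) :
    Continuous (fibrePoint κ y) := by
  refine (canonicalChart κ).continuousOn_symm.comp_continuous (by fun_prop) fun p => ?_
  exact mem_canonicalChart_target.2 (κ.total.map_source hy)

/-- For `n ≠ 1` a multisymplectic diffeomorphism maps fibres over `Y` to fibres over `Y`: its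
differential preserves the momentum directions, so the image point in `Y` is locally constant
along a fibre, and the fibres are connected. -/
theorem IsMultisymplectic.proj_eq (hn : n ≠ 1)
    {Φ : π.Legendre ≃ₘ⟮modelLegendre n m, modelLegendre n m⟯ π.Legendre}
    (hΦ : IsMultisymplectic Φ) {q q' : π.Legendre} (hqq' : q.proj = q'.proj) :
    (Φ q).proj = (Φ q').proj := by
  obtain ⟨f, hf, h⟩ := hΦ
  obtain ⟨κ, hq⟩ := π.exists_fibredChart q.proj
  have hconst : IsLocallyConstant fun p => (Φ (fibrePoint κ q.proj p)).proj := by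
    rw [IsLocallyConstant.iff_eventually_eq]
    intro p₀
    obtain ⟨κ', hκ'⟩ := π.exists_fibredChart (Φ (fibrePoint κ q.proj p₀)).proj
    have hcont : Continuous fun p => (Φ (fibrePoint κ q.proj p)).proj :=
      contMDiff_legendreProj.continuous.comp (Φ.continuous.comp (continuous_fibrePoint hq))
    obtain ⟨ε, hε, hball⟩ := Metric.isOpen_iff.1 (κ'.total.open_source.preimage hcont) p₀ hκ'
    filter_upwards [Metric.ball_mem_nhds p₀ hε] with p hp
    have hder : ∀ p ∈ Metric.ball p₀ ε, HasFDerivAt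
        (fun p => (canonicalRep κ κ' Φ (κ.total q.proj, p)).1)
        (0 : (Euc m →L[ℝ] Euc n) →L[ℝ] (Euc n × Euc m)) p := by
      intro p hp
      have hs : (fibrePoint κ q.proj p).proj ∈ κ.total.source := by rwa [fibrePoint_proj hq]
      have hs' := hball hp
      have hΦq := Φ.contMDiff.contMDiffAt (x := fibrePoint κ q.proj p)
      have hx' : f (π.proj (fibrePoint κ q.proj p).proj) ∈ κ'.base.source := by
        rw [← hf]; exact κ'.proj_mem _ hs'
      have hL := fderiv_canonicalRep_fst_fst hΦq f.contMDiff.contMDiffAt hf hs hs'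
      have hsymp := (multisymplecticForm_map_eq_iff Φ f hf hs hs').1 (h _ κ κ' hs hs')
      have hzero := snd_fst_map_momentum_eq_zero hn
        (det_baseJacobian_ne_zero_of_diffeomorph f (κ.proj_mem _ hs) hx') hL hsymp
      have hd := ((contDiffAt_canonicalRep hΦq hs hs').differentiableAt (by simp)).hasFDerivAt
      rw [canonicalCoord_fibrePoint hq] at hd hL hzero
      have h1 := HasFDerivAt.comp p (f := fun p => (κ.total q.proj, p)) hd
        ((hasFDerivAt_const (κ.total q.proj) p).prodMk (hasFDerivAt_id p))
      refine h1.fst.congr_fderiv (ContinuousLinearMap.ext fun δ => Prod.ext ?_ (hzero δ))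
      exact (hL (0, δ)).trans (map_zero _)
    have hEq := Metric.isOpen_ball.is_const_of_fderiv_eq_zero (𝕜 := ℝ)
      (convex_ball p₀ ε).isPreconnected
      (fun p hp => (hder p hp).differentiableAt.differentiableWithinAt)
      (fun p hp => (hder p hp).fderiv) hp (Metric.mem_ball_self hε)
    exact κ'.total.injOn (hball hp) hκ' hEq
  have h1 := hconst.apply_eq_of_isPreconnected isPreconnected_univ
    (Set.mem_univ (canonicalCoord κ q).2) (Set.mem_univ (canonicalCoord κ q').2)
  rw [fibrePoint_canonicalCoord hq] at h1
  rw [h1, hqq', fibrePoint_canonicalCoord (by rwa [← hqq'])]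

/-- The diffeomorphism of `Y` induced by a multisymplectic diffeomorphism. -/
theorem IsMultisymplectic.exists_induced (hn : n ≠ 1)
    {Φ : π.Legendre ≃ₘ⟮modelLegendre n m, modelLegendre n m⟯ π.Legendre}
    (hΦ : IsMultisymplectic Φ) :
    ∃ φ : Y ≃ₘ⟮𝓘(ℝ, Euc n × Euc m), 𝓘(ℝ, Euc n × Euc m)⟯ Y, ∀ q, (Φ q).proj = φ q.proj := by
  refine ⟨⟨⟨fun y => (Φ ⟨y, 0⟩).proj, fun y => (Φ.symm ⟨y, 0⟩).proj, fun y => ?_, fun y => ?_⟩,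
    contMDiff_legendreProj.comp (Φ.contMDiff.comp contMDiff_legendreZero),
    contMDiff_legendreProj.comp (Φ.symm.contMDiff.comp contMDiff_legendreZero)⟩,
    fun q => hΦ.proj_eq hn rfl⟩
  · dsimp only
    rw [hΦ.symm.proj_eq hn (q := ⟨(Φ ⟨y, 0⟩).proj, 0⟩) (q' := Φ ⟨y, 0⟩) rfl,
      Φ.symm_apply_apply]
  · dsimp only
    rw [hΦ.proj_eq hn (q := ⟨(Φ.symm ⟨y, 0⟩).proj, 0⟩) (q' := Φ.symm ⟨y, 0⟩) rfl,
      Φ.apply_symm_apply]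

/-- Along the fibres over `Y` a multisymplectic diffeomorphism is affine, with linear part the
momentum transformation of the induced isomorphism. -/
theorem canonicalCoord_snd_map (Φ : π.Legendre ≃ₘ⟮modelLegendre n m, modelLegendre n m⟯ π.Legendre)
    (f : X ≃ₘ⟮𝓘(ℝ, Euc n), 𝓘(ℝ, Euc n)⟯ X)
    (φ : Y ≃ₘ⟮𝓘(ℝ, Euc n × Euc m), 𝓘(ℝ, Euc n × Euc m)⟯ Y)
    (hf : ∀ q, π.proj (Φ q).proj = f (π.proj q.proj))
    (hφf : ∀ y, π.proj (φ y) = f (π.proj y))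
    (hφ : ∀ q, (Φ q).proj = φ q.proj)
    (h : ∀ (q : π.Legendre) (κ κ' : π.FibredChart),
      q.proj ∈ κ.total.source → (Φ q).proj ∈ κ'.total.source →
      ∀ u : Fin (n + 2) → TangentSpace (modelLegendre n m) q,
        multisymplecticForm κ' (Φ q)
            (fun a => mfderiv (modelLegendre n m) (modelLegendre n m) Φ q (u a)) =
          mfderiv 𝓘(ℝ, Euc n) 𝓘(ℝ, Euc n) f (π.proj q.proj) (multisymplecticForm κ q u))
    {q : π.Legendre} (hq : q.proj ∈ κ.total.source) (hq' : φ q.proj ∈ κ'.total.source) :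
    (canonicalCoord κ' (Φ q)).2 = (canonicalCoord κ' (Φ ⟨q.proj, 0⟩)).2 +
      momentumTransform (baseJacobian κ κ' f (π.proj q.proj))
        (vertJacobian κ' κ φ.symm (φ q.proj)) (canonicalCoord κ q).2 := by
  set M := momentumTransform (baseJacobian κ κ' f (π.proj q.proj))
        (vertJacobian κ' κ φ.symm (φ q.proj)) with hM
  have hs0 : φ.symm (φ q.proj) = q.proj := φ.symm_apply_apply _
  have hinv : ∀ η, vertJacobian κ κ' φ q.proj (vertJacobian κ' κ φ.symm (φ q.proj) η) = η := by
    have hφs : ∀ y, π.proj (φ.symm y) = f.symm (π.proj y) := by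
      intro y
      rw [← f.symm_apply_apply (π.proj (φ.symm y)), ← hφf, φ.apply_symm_apply]
    intro η
    have := vertJacobian_symm_apply φ.symm f.symm hφs hq' (by rwa [hs0] : _ ∈ κ.total.source) η
    rwa [hs0] at this
  have hder : ∀ p, HasFDerivAt (fun p => (canonicalRep κ κ' Φ (κ.total q.proj, p)).2 - M p)
      (0 : (Euc m →L[ℝ] Euc n) →L[ℝ] (Euc m →L[ℝ] Euc n)) p := by
    intro p
    have hpr := fibrePoint_proj (κ := κ) hq p
    have hs : (fibrePoint κ q.proj p).proj ∈ κ.total.source := by rwa [hpr]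
    have hs' : (Φ (fibrePoint κ q.proj p)).proj ∈ κ'.total.source := by rwa [hφ, hpr]
    have hΦq := Φ.contMDiff.contMDiffAt (x := fibrePoint κ q.proj p)
    have hx' : f (π.proj (fibrePoint κ q.proj p).proj) ∈ κ'.base.source := by
      rw [← hf]; exact κ'.proj_mem _ hs'
    have hdet := det_baseJacobian_ne_zero_of_diffeomorph f (κ.proj_mem _ hs) hx'
    have hsymp := (multisymplecticForm_map_eq_iff Φ f hf hs hs').1 (h _ κ κ' hs hs')
    have hL := fderiv_canonicalRep_fst_fst hΦq f.contMDiff.contMDiffAt hf hs hs'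
    have hd := ((contDiffAt_canonicalRep hΦq hs hs').differentiableAt (by simp)).hasFDerivAt
    have hev := eventually_canonicalChart_symm_mem hΦq.continuousAt hs hs'
    rw [canonicalCoord_fibrePoint hq] at hd hsymp hL hev
    rw [hpr] at hdet hsymp hL
    set L := fderiv ℝ (canonicalRep κ κ' Φ) (κ.total q.proj, p) with hLdef
    -- The `Y`-component of the representative is that of the induced diffeomorphism.
    have hL1 : ∀ u, (L u).1 =
        fderiv ℝ (κ'.total ∘ φ ∘ κ.total.symm) (κ.total q.proj) u.1 := by
      have h1 := ((contDiffAt_totalRep φ.contMDiff.contMDiffAt hq hq').differentiableAt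
        (by simp)).hasFDerivAt
      have h2 := HasFDerivAt.comp (𝕜 := ℝ) (κ.total q.proj, p) (f := Prod.fst)
        (g := κ'.total ∘ φ ∘ κ.total.symm) h1 hasFDerivAt_fst
      have heq : (fun c => (canonicalRep κ κ' Φ c).1) =
          (κ'.total ∘ φ ∘ κ.total.symm) ∘ Prod.fst := by
        funext c
        change κ'.total (Φ ((canonicalChart κ).symm c)).proj = _
        rw [hφ, canonicalChart_symm_proj]
        rfl
      have h3 := hd.fst
      rw [heq] at h3
      intro u
      exact congrArg (fun T => T u) (h3.unique h2)
    have h0 : ∀ p, (L (0, p)).1.2 = 0 := by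
      intro p
      rw [hL1, map_zero]
      rfl
    have hLM : ∀ δ, (L (0, δ)).2 = M δ := by
      intro δ
      ext1 η
      have h1 := snd_map_momentum_comp hdet hsymp h0 δ (vertJacobian κ' κ φ.symm (φ q.proj) η)
      have h2 : (L ((0, vertJacobian κ' κ φ.symm (φ q.proj) η), 0)).1.2 = η := by
        rw [hL1]
        exact hinv η
      rw [h2] at h1
      exact h1
    have h1 := HasFDerivAt.comp p (f := fun p => (κ.total q.proj, p)) hd
      ((hasFDerivAt_const (κ.total q.proj) p).prodMk (hasFDerivAt_id p))
    refine (h1.snd.sub M.hasFDerivAt).congr_fderiv (ContinuousLinearMap.ext fun δ => ?_)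
    exact sub_eq_zero.2 (hLM δ)
  have hEq := is_const_of_fderiv_eq_zero (𝕜 := ℝ) (fun p => (hder p).differentiableAt)
    (fun p => (hder p).fderiv) (canonicalCoord κ q).2 0
  have e1 : canonicalRep κ κ' Φ (κ.total q.proj, (canonicalCoord κ q).2) =
      canonicalCoord κ' (Φ q) :=
    congrArg (fun q => canonicalCoord κ' (Φ q)) (fibrePoint_canonicalCoord hq)
  have e2 : canonicalRep κ κ' Φ (κ.total q.proj, 0) = canonicalCoord κ' (Φ ⟨q.proj, 0⟩) := by
    have := fibrePoint_canonicalCoord (κ := κ) (q := ⟨q.proj, 0⟩) hq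
    rw [canonicalCoord_snd_zero] at this
    exact congrArg (fun q => canonicalCoord κ' (Φ q)) this
  rw [e1, e2, map_zero, sub_zero] at hEq
  exact sub_eq_iff_eq_add.1 hEq

/-- A smooth map that assigns to each point of `Y` an element of the Legendre bundle over it is a
smooth section. -/
theorem exists_section_eq (s : Y → π.Legendre)
    (hs : ContMDiff 𝓘(ℝ, Euc n × Euc m) (modelLegendre n m) ∞ s) (h : ∀ y, (s y).proj = y) :
    ∃ r : LegendreSection π, ∀ y, (⟨y, r y⟩ : π.Legendre) = s y := by
  have key : ∀ (t : π.Legendre) (y : Y) (hy : t.proj = y),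
      (⟨y, hy ▸ t.snd⟩ : π.Legendre) = t := by
    rintro t y rfl
    rfl
  have hsec : (fun y => (⟨y, h y ▸ (s y).snd⟩ : π.Legendre)) = s := funext fun y => key _ _ (h y)
  refine ⟨⟨fun y => h y ▸ (s y).snd, ?_⟩, fun y => key _ _ (h y)⟩
  change ContMDiff _ _ _ (fun y => (⟨y, h y ▸ (s y).snd⟩ : π.Legendre))
  rw [hsec]
  exact hs

/-- For `n ≠ 1` a multisymplectic diffeomorphism is an isomorphism of the Legendre manifold
followed by the translation by the image of the zero section. -/
theorem IsMultisymplectic.exists_eq_translation_comp (hn : n ≠ 1)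
    {Φ : π.Legendre ≃ₘ⟮modelLegendre n m, modelLegendre n m⟯ π.Legendre}
    (hΦ : IsMultisymplectic Φ) :
    ∃ (G : π.Legendre ≃ₘ⟮modelLegendre n m, modelLegendre n m⟯ π.Legendre)
      (r : LegendreSection π), IsLegendreIso G ∧ ∀ q, Φ q = translation r (G q) := by
  obtain ⟨φ, hφ⟩ := hΦ.exists_induced hn
  obtain ⟨f, hf, h⟩ := hΦ
  have hφf : ∀ y, π.proj (φ y) = f (π.proj y) := by
    intro y
    have := hf ⟨y, 0⟩
    rwa [hφ] at this
  obtain ⟨r, hr⟩ := exists_section_eq (fun y => Φ ⟨φ.symm y, 0⟩)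
    (Φ.contMDiff.comp (contMDiff_legendreZero.comp φ.symm.contMDiff))
    (fun y => by rw [hφ]; exact φ.apply_symm_apply y)
  refine ⟨Φ.trans (translationDiffeomorph (-r)), r, ⟨φ, f, hφf, hφ, ?_⟩,
    fun q => (translation_translation_neg r (Φ q)).symm⟩
  intro q κ κ' hq hq'
  have h1 : canonicalCoord κ' (translation (-r) (Φ q)) =
    canonicalCoord κ' ⟨(Φ q).proj, (Φ q).snd + -r (Φ q).proj⟩ := rfl
  have h2 : (⟨(Φ q).proj, r (Φ q).proj⟩ : π.Legendre) = Φ ⟨q.proj, 0⟩ := by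
    rw [hr, hφ, φ.symm_apply_apply]
  change (canonicalCoord κ' (translation (-r) (Φ q))).2 = _
  rw [h1, canonicalCoord_snd_add, canonicalCoord_snd_neg, h2,
    show (⟨(Φ q).proj, (Φ q).snd⟩ : π.Legendre) = Φ q from rfl,
    canonicalCoord_snd_map Φ f φ hf hφf hφ h hq hq']
  abel

end

/-! ### Closedness of the contracted forms -/

section

variable {n m : ℕ} {X Y : Type*}
  [TopologicalSpace X] [ChartedSpace (Euc n) X]
  [TopologicalSpace Y] [ChartedSpace (Euc n × Euc m) Y]
  [IsManifold 𝓘(ℝ, Euc n) ∞ X] [IsManifold 𝓘(ℝ, Euc n × Euc m) ∞ Y]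
  {π : FibredManifold n m X Y} {κ κ' : π.FibredChart}

/-- Every covector at a point of `X` is the value of a global smooth `1`-form. -/
theorem exists_oneForm_eq [T2Space X] (x : X) (α : TangentSpace 𝓘(ℝ, Euc n) x →L[ℝ] ℝ) :
    ∃ φ : OneForm n X, φ x = α := by
  let V : X → Type _ := fun x : X => TangentSpace 𝓘(ℝ, Euc n) x →L[ℝ] Bundle.Trivial X ℝ x
  obtain ⟨s, hs, hext⟩ := FiberBundle.exists_contMDiffOn_extend (k := ∞) 𝓘(ℝ, Euc n)
    (Euc n →L[ℝ] ℝ) (V := V) (x₀ := x) α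
  obtain ⟨u, hus, hu, hxu⟩ := mem_nhds_iff.1 hs
  obtain ⟨ρ, -, hρ⟩ := (SmoothBumpFunction.nhds_basis_tsupport (I := 𝓘(ℝ, Euc n)) x).mem_iff.1
    (hu.mem_nhds hxu)
  refine ⟨⟨fun x' => ρ x' • FiberBundle.extend (Euc n →L[ℝ] ℝ) (E := V) α x', ?_⟩, ?_⟩
  · exact ContMDiffOn.smul_section_of_tsupport ρ.contMDiff.contMDiffOn hu hρ (hext.mono hus)
  · change ρ x • FiberBundle.extend (Euc n →L[ℝ] ℝ) (E := V) α x = α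
    rw [FiberBundle.extend_apply_self, ρ.eq_one, one_smul]

theorem differentiableAt_oneFormCoord (φ : OneForm n X) (l : Fin n) {x : Euc n}
    (hx : x ∈ κ.base.target) : DifferentiableAt ℝ (oneFormCoord φ κ l) x := by
  have hsm := contMDiffOn_symm_of_mem_maximalAtlas κ.base_mem
  have h1 := hsm.contMDiffOn_tangentMapWithin (m := 1) (by norm_cast)
    κ.base.open_target.uniqueMDiffOn
  have h2 : ContMDiff 𝓘(ℝ, Euc n) 𝓘(ℝ, Euc n).tangent 1
      (fun x => (⟨x, EuclideanSpace.single l (1 : ℝ)⟩ : TangentBundle 𝓘(ℝ, Euc n) (Euc n))) := by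
    intro x
    exact contMDiffAt_vectorSpace_iff_contDiffAt.2 contDiffAt_const
  have h3 := (h1.contMDiffAt (x := ⟨x, EuclideanSpace.single l (1 : ℝ)⟩)
    ((κ.base.open_target.preimage (FiberBundle.continuous_proj (Euc n) _)).mem_nhds hx)).comp x
      (h2 x)
  have h4 : ContMDiffAt 𝓘(ℝ, Euc n) (𝓘(ℝ, Euc n).prod 𝓘(ℝ, Euc n →L[ℝ] ℝ)) 1
      (fun x => (⟨κ.base.symm x, φ (κ.base.symm x)⟩ : Bundle.TotalSpace (Euc n →L[ℝ] ℝ)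
        (fun x : X => TangentSpace 𝓘(ℝ, Euc n) x →L[ℝ] Bundle.Trivial X ℝ x))) x :=
    ((φ.contMDiff (κ.base.symm x)).of_le (by norm_cast)).comp x ((hsm.contMDiffAt
      (κ.base.open_target.mem_nhds hx)).of_le (by norm_cast))
  have h3' : ContMDiffAt 𝓘(ℝ, Euc n) (𝓘(ℝ, Euc n).prod 𝓘(ℝ, Euc n)) 1
      (fun x => (⟨κ.base.symm x, mfderiv 𝓘(ℝ, Euc n) 𝓘(ℝ, Euc n) κ.base.symm x
        (EuclideanSpace.single l (1 : ℝ))⟩ : TangentBundle 𝓘(ℝ, Euc n) X)) x := by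
    refine h3.congr_of_eventuallyEq ?_
    filter_upwards [κ.base.open_target.mem_nhds hx] with z hz
    simp only [Function.comp_apply, tangentMapWithin]
    rw [mfderivWithin_of_mem_nhds (κ.base.open_target.mem_nhds hz)]
  have h5 := h4.clm_bundle_apply (F₁ := Euc n) (F₂ := ℝ) h3'
  have h6 := (Bundle.contMDiffAt_totalSpace.1 h5).2
  exact (contMDiffAt_iff_contDiffAt.1 h6).differentiableAt (by simp)

theorem hasFDerivAt_sectionCoord (r : LegendreSection π) {z : Euc n × Euc m}
    (hz : z ∈ κ.total.target) (l : Fin n) (i : Fin m) :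
    HasFDerivAt (sectionCoord r κ l i) ((EuclideanSpace.proj l : Euc n →L[ℝ] ℝ) ∘L
      (ContinuousLinearMap.apply ℝ (Euc n) (EuclideanSpace.single i (1 : ℝ))) ∘L
        fderiv ℝ (sectionRep r κ) z) z := by
  have h := ((contDiffAt_sectionRep r hz).differentiableAt (by simp)).hasFDerivAt
  exact (EuclideanSpace.proj l : Euc n →L[ℝ] ℝ).hasFDerivAt.comp z
    ((ContinuousLinearMap.apply ℝ (Euc n) (EuclideanSpace.single i (1 : ℝ))).hasFDerivAt.comp z h)

theorem hasSymmetricDerivative_iff_coord (r : LegendreSection π) :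
    HasSymmetricDerivative r ↔
      ∀ (κ : π.FibredChart), ∀ z ∈ κ.total.target, ∀ (l : Fin n) (i j : Fin m),
        fderiv ℝ (sectionCoord r κ l i) z (0, EuclideanSpace.single j (1 : ℝ)) =
          fderiv ℝ (sectionCoord r κ l j) z (0, EuclideanSpace.single i (1 : ℝ)) := by
  constructor
  · intro h κ z hz l i j
    rw [(hasFDerivAt_sectionCoord r hz l i).fderiv, (hasFDerivAt_sectionCoord r hz l j).fderiv]
    exact congrArg (fun ξ : Euc n => ξ l) (h κ z hz _ _)
  · intro h κ z hz η η'
    let D : Euc m →ₗ[ℝ] Euc m →ₗ[ℝ] Euc n :=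
      LinearMap.mk₂ ℝ (fun η η' => fderiv ℝ (sectionRep r κ) z (0, η) η')
        (fun a b c => by
          rw [← add_apply, ← map_add, Prod.mk_add_mk, add_zero])
        (fun a b c => by
          rw [← smul_apply, ← map_smul, Prod.smul_mk, smul_zero])
        (fun a b c => map_add _ _ _) (fun a b c => map_smul _ _ _)
    have hD : D = D.flip := by
      refine (EuclideanSpace.basisFun (Fin m) ℝ).toBasis.ext fun j =>
        (EuclideanSpace.basisFun (Fin m) ℝ).toBasis.ext fun i => ?_
      ext l
      have := h κ z hz l i j
      rw [(hasFDerivAt_sectionCoord r hz l i).fderiv,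
        (hasFDerivAt_sectionCoord r hz l j).fderiv] at this
      simpa [D] using this
    exact congrArg (fun B => B η η') hD

/-- The exterior derivative of `r⌋φ` on two vertical vectors: since `φ` comes from the base, only
the coefficients of `r` are differentiated. -/
theorem extDeriv_contractionForm (r : LegendreSection π) (φ : OneForm n X) {z : Euc n × Euc m}
    (hz : z ∈ κ.total.target) (u v : Canon n m) (w : Fin n → Canon n m)
    (hu : u.1.1 = 0) (hv : v.1.1 = 0) :
    (extDeriv (contractionForm r φ κ) z).compContinuousLinearMap
      (ContinuousLinearMap.fst ℝ (Euc n × Euc m) (Euc m →L[ℝ] Euc n))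
        (Fin.cons u (Fin.cons v w) : Fin (n + 2) → Canon n m) =
      omega n (fun a => (w a).1.1) * ∑ l, oneFormCoord φ κ l z.1 *
        (fderiv ℝ (sectionRep r κ) z u.1 v.1.2 - fderiv ℝ (sectionRep r κ) z v.1 u.1.2) l := by
  have hzb : z.1 ∈ κ.base.target := by
    have hs := κ.total.map_target hz
    rw [← κ.total.right_inv hz, κ.fst_total _ hs]
    exact κ.base.map_source (κ.proj_mem _ hs)
  let da : Fin n → Fin m → (Euc n × Euc m) →L[ℝ] ℝ := fun l i =>
    sectionCoord r κ l i z • (fderiv ℝ (oneFormCoord φ κ l) z.1 ∘L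
      ContinuousLinearMap.fst ℝ (Euc n) (Euc m)) +
    oneFormCoord φ κ l z.1 • ((EuclideanSpace.proj l : Euc n →L[ℝ] ℝ) ∘L
      (ContinuousLinearMap.apply ℝ (Euc n) (EuclideanSpace.single i (1 : ℝ))) ∘L
        fderiv ℝ (sectionRep r κ) z)
  have hda : ∀ l i, HasFDerivAt (fun z => sectionCoord r κ l i z * oneFormCoord φ κ l z.1)
      (da l i) z := fun l i =>
    (hasFDerivAt_sectionCoord r hz l i).mul (HasFDerivAt.comp z (f := Prod.fst)
      (g := oneFormCoord φ κ l) (differentiableAt_oneFormCoord φ l hzb).hasFDerivAt hasFDerivAt_fst)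
  have hder : HasFDerivAt (contractionForm r φ κ) (∑ l, ∑ i, (da l i).smulRight (dyOmega n i)) z :=
    HasFDerivAt.fun_sum fun l _ => HasFDerivAt.fun_sum fun i _ => (hda l i).smul_const (dyOmega n i)
  have hext : extDeriv (contractionForm r φ κ) z = ∑ l, ∑ i, wedge (da l i) (dyOmega n i) := by
    rw [extDeriv, hder.fderiv, ← ContinuousAlternatingMap.alternatizeUncurryFinCLM_apply]
    simp only [map_sum]
    rfl
  have hpull : ∀ l i, (wedge (da l i) (dyOmega n i)).compContinuousLinearMap
      (ContinuousLinearMap.fst ℝ (Euc n × Euc m) (Euc m →L[ℝ] Euc n)) =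
      wedge (da l i ∘L (ContinuousLinearMap.fst ℝ (Euc n × Euc m) (Euc m →L[ℝ] Euc n)))
        ((dyOmega n i).compContinuousLinearMap
          (ContinuousLinearMap.fst ℝ (Euc n × Euc m) (Euc m →L[ℝ] Euc n))) := by
    intro l i
    ext u
    simp only [wedge, ContinuousAlternatingMap.compContinuousLinearMap_apply,
      ContinuousAlternatingMap.alternatizeUncurryFin_apply]
    rfl
  have hsum : (extDeriv (contractionForm r φ κ) z).compContinuousLinearMap
      (ContinuousLinearMap.fst ℝ (Euc n × Euc m) (Euc m →L[ℝ] Euc n))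
        (Fin.cons u (Fin.cons v w) : Fin (n + 2) → Canon n m) =
      ∑ l, ∑ i, (wedge (da l i) (dyOmega n i)).compContinuousLinearMap
        (ContinuousLinearMap.fst ℝ (Euc n × Euc m) (Euc m →L[ℝ] Euc n))
        (Fin.cons u (Fin.cons v w) : Fin (n + 2) → Canon n m) := by
    rw [hext]
    simp [ContinuousAlternatingMap.compContinuousLinearMap_apply,
      ContinuousAlternatingMap.sum_apply]
  have hdav : ∀ l i (u : Canon n m), u.1.1 = 0 → da l i u.1 = oneFormCoord φ κ l z.1 *
      fderiv ℝ (sectionRep r κ) z u.1 (EuclideanSpace.single i 1) l := by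
    intro l i u hu
    simp [da, hu]
  rw [hsum, Finset.mul_sum]
  refine Finset.sum_congr rfl fun l _ => ?_
  simp only [hpull, wedge_dyOmega_cons_cons _ _ u v w hu hv, ContinuousLinearMap.comp_apply,
    ContinuousLinearMap.coe_fst', hdav l _ u hu, hdav l _ v hv, PiLp.sub_apply]
  rw [apply_eq_sum_single _ v.1.2, apply_eq_sum_single _ u.1.2, ← Finset.sum_sub_distrib,
    Finset.mul_sum, Finset.mul_sum]
  refine Finset.sum_congr rfl fun i _ => ?_
  ring

/-- All the forms `r⌋φ` are closed if and only if `r` has a symmetric vertical derivative: for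
arbitrary values of `φ` at a point the components of the derivative of `r` can be separated. -/
theorem contractionClosed_iff_hasSymmetricDerivative [T2Space X] (r : LegendreSection π) :
    (∀ φ : OneForm n X, ContractionClosed r φ) ↔ HasSymmetricDerivative r := by
  constructor
  · intro h κ z hz η η'
    have hs := κ.total.map_target hz
    have hx := κ.proj_mem _ hs
    have hz1 : z.1 = κ.base (π.proj (κ.total.symm z)) := by
      rw [← κ.fst_total _ hs, κ.total.right_inv hz]
    ext l
    -- A `1`-form with coordinates `δ_λ` at the point singles out the component `l`.
    let α : TangentSpace 𝓘(ℝ, Euc n) (κ.base.symm z.1) →L[ℝ] ℝ :=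
      (EuclideanSpace.proj l : Euc n →L[ℝ] ℝ) ∘L
        (mfderiv 𝓘(ℝ, Euc n) 𝓘(ℝ, Euc n) κ.base (κ.base.symm z.1))
    obtain ⟨φ, hφ⟩ := exists_oneForm_eq (κ.base.symm z.1) α
    have hφl : ∀ l', oneFormCoord φ κ l' z.1 = (EuclideanSpace.single l' (1 : ℝ) : Euc n) l := by
      intro l'
      rw [oneFormCoord, hφ]
      have := mfderiv_chart_symm_apply hx (contMDiffAt_base hx) (contMDiffAt_base_symm hx)
        (EuclideanSpace.single l' (1 : ℝ))
      have hb : κ.base.symm z.1 = π.proj (κ.total.symm z) := by rw [hz1, κ.base.left_inv hx]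
      change (EuclideanSpace.proj l : Euc n →L[ℝ] ℝ)
        (mfderiv 𝓘(ℝ, Euc n) 𝓘(ℝ, Euc n) κ.base (κ.base.symm z.1)
          (mfderiv 𝓘(ℝ, Euc n) 𝓘(ℝ, Euc n) κ.base.symm z.1 (EuclideanSpace.single l' (1 : ℝ)))) = _
      rw [hb, hz1]
      exact congrArg (fun ξ : Euc n => ξ l) this
    have h1 := extDeriv_contractionForm r φ hz ((0, η), 0) ((0, η'), 0)
      (fun a => ((EuclideanSpace.single a (1 : ℝ), 0), 0)) rfl rfl
    rw [h φ κ z hz, omega_single, one_mul, Finset.sum_eq_single l] at h1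
    · rw [hφl] at h1
      exact sub_eq_zero.1 (by simpa using h1.symm)
    · intro l' _ hl
      rw [hφl]
      simp [hl.symm]
    · simp
  · intro h φ κ z hz
    have h0 : (extDeriv (contractionForm r φ κ) z).compContinuousLinearMap
        (ContinuousLinearMap.fst ℝ (Euc n × Euc m) (Euc m →L[ℝ] Euc n)) = 0 := by
      refine alternating_eq_of_vertical fun u v w hu hv => ?_
      rw [extDeriv_contractionForm r φ hz u v w hu hv]
      have hu' : u.1 = (0, u.1.2) := Prod.ext hu rfl
      have hv' : v.1 = (0, v.1.2) := Prod.ext hv rfl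
      have := h κ z hz u.1.2 v.1.2
      rw [← hu', ← hv'] at this
      simp [this]
    ext u
    exact congrArg (fun β => β fun a => (u a, (0 : Euc m →L[ℝ] Euc n))) h0

end

/-! ### Uniqueness and conjugation -/

section

variable {n m : ℕ} {X Y : Type*}
  [TopologicalSpace X] [ChartedSpace (Euc n) X]
  [TopologicalSpace Y] [ChartedSpace (Euc n × Euc m) Y]
  [IsManifold 𝓘(ℝ, Euc n) ∞ X] [IsManifold 𝓘(ℝ, Euc n × Euc m) ∞ Y]
  {π : FibredManifold n m X Y} {κ κ' : π.FibredChart}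

/-- Isomorphisms preserve the zero section, so the translation is recovered from the image of the
zero section under the composition. -/
theorem translation_comp_legendreIso_unique
    {G G' : π.Legendre ≃ₘ⟮modelLegendre n m, modelLegendre n m⟯ π.Legendre}
    {r r' : LegendreSection π} (hG : IsLegendreIso G) (hG' : IsLegendreIso G')
    (h : ∀ q, translation r (G q) = translation r' (G' q)) : G = G' ∧ r = r' := by
  -- An isomorphism maps the zero section to itself.
  have hzero : ∀ {G : π.Legendre ≃ₘ⟮modelLegendre n m, modelLegendre n m⟯ π.Legendre}
      (φ : Y ≃ₘ⟮𝓘(ℝ, Euc n × Euc m), 𝓘(ℝ, Euc n × Euc m)⟯ Y)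
      (f : X ≃ₘ⟮𝓘(ℝ, Euc n), 𝓘(ℝ, Euc n)⟯ X),
      (∀ q : π.Legendre, (G q).proj = φ q.proj) →
      (∀ (q : π.Legendre) (κ κ' : π.FibredChart),
        q.proj ∈ κ.total.source → φ q.proj ∈ κ'.total.source →
        (canonicalCoord κ' (G q)).2 =
          momentumTransform (baseJacobian κ κ' f (π.proj q.proj))
            (vertJacobian κ' κ φ.symm (φ q.proj)) (canonicalCoord κ q).2) →
      ∀ y, G ⟨y, 0⟩ = ⟨φ y, 0⟩ := by
    intro G φ f hp hm y
    obtain ⟨κ, hκ⟩ := π.exists_fibredChart y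
    obtain ⟨κ', hκ'⟩ := π.exists_fibredChart (φ y)
    refine canonicalCoord_injOn (κ := κ') (by rwa [hp]) hκ' (Prod.ext ?_ ?_)
    · exact congrArg κ'.total (hp ⟨y, 0⟩)
    · rw [hm ⟨y, 0⟩ κ κ' hκ hκ', canonicalCoord_snd_zero, canonicalCoord_snd_zero, map_zero]
  obtain ⟨φ, f, -, hp, hm⟩ := hG
  obtain ⟨φ', f', -, hp', hm'⟩ := hG'
  have hr : r = r' := by
    ext y
    have h1 := h ⟨φ.symm y, 0⟩
    have hφ : φ' (φ.symm y) = y := by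
      have h2 : (translation r (G ⟨φ.symm y, 0⟩)).proj =
          (translation r' (G' ⟨φ.symm y, 0⟩)).proj := by rw [h1]
      change (G ⟨φ.symm y, 0⟩).proj = (G' ⟨φ.symm y, 0⟩).proj at h2
      rw [hp, hp'] at h2
      exact h2.symm.trans (φ.apply_symm_apply y)
    rw [hzero φ f hp hm, hzero φ' f' hp' hm', hφ, φ.apply_symm_apply] at h1
    have h2 : (⟨y, 0 + r y⟩ : π.Legendre) = ⟨y, 0 + r' y⟩ := h1
    rw [zero_add, zero_add] at h2
    exact Bundle.TotalSpace.mk_inj.1 h2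
  subst hr
  refine ⟨?_, rfl⟩
  ext1 q
  exact (translationDiffeomorph r).injective (h q)

/-- An isomorphism is linear on the fibres over `Y`, so it conjugates the translation by `r` to
the translation by the image of `r`. -/
theorem IsLegendreIso.exists_conjugate_translation
    {G : π.Legendre ≃ₘ⟮modelLegendre n m, modelLegendre n m⟯ π.Legendre} (hG : IsLegendreIso G)
    (r : LegendreSection π) :
    ∃ r' : LegendreSection π, ∀ q, G (translation r q) = translation r' (G q) := by
  obtain ⟨φ, f, -, hp, hm⟩ := hG
  obtain ⟨r', hr'⟩ := exists_section_eq (fun y => G ⟨φ.symm y, r (φ.symm y)⟩)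
    (G.contMDiff.comp (r.contMDiff.comp φ.symm.contMDiff))
    (fun y => by rw [hp]; exact φ.apply_symm_apply y)
  refine ⟨r', fun q => ?_⟩
  obtain ⟨κ, hκ⟩ := π.exists_fibredChart q.proj
  obtain ⟨κ', hκ'⟩ := π.exists_fibredChart (φ q.proj)
  have hr : (⟨(G q).proj, r' (G q).proj⟩ : π.Legendre) = G ⟨q.proj, r q.proj⟩ := by
    rw [hr', hp, φ.symm_apply_apply]
  have h1 : (translation r' (G q)).proj = φ q.proj := hp q
  refine canonicalCoord_injOn (κ := κ') (by rw [hp]; exact hκ') (by rwa [h1]) (Prod.ext ?_ ?_)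
  · exact congrArg κ'.total ((hp _).trans (hp q).symm)
  · have e1 := hm (translation r q) κ κ' hκ hκ'
    have e2 := canonicalCoord_snd_add (κ := κ') (G q).proj (G q).snd (r' (G q).proj)
    have e3 := canonicalCoord_snd_add (κ := κ) q.proj q.snd (r q.proj)
    rw [hr, hm ⟨q.proj, r q.proj⟩ κ κ' hκ hκ'] at e2
    refine e1.trans (Eq.trans ?_ e2.symm)
    refine (congrArg _ e3).trans ((map_add _ _ _).trans ?_)
    exact congrArg (· + _) (hm q κ κ' hκ hκ').symm

end

end FibredManifold
end Multisymplectic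
end

theorem proposition12p7 (n m : ℕ) (hn : n ≠ 1) {X Y : Type*}
    [TopologicalSpace X] [T2Space X] [SecondCountableTopology X]
    [ChartedSpace (Euc n) X] [IsManifold 𝓘(ℝ, Euc n) ∞ X]
    [TopologicalSpace Y] [T2Space Y] [SecondCountableTopology Y]
    [ChartedSpace (Euc n × Euc m) Y] [IsManifold 𝓘(ℝ, Euc n × Euc m) ∞ Y]
    (π : FibredManifold n m X Y) :
    -- the multisymplectic diffeomorphisms are the products of isomorphisms and translations
    (∀ Φ : π.Legendre ≃ₘ⟮modelLegendre n m, modelLegendre n m⟯ π.Legendre,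
      IsMultisymplectic Φ ↔
        ∃ (G : π.Legendre ≃ₘ⟮modelLegendre n m, modelLegendre n m⟯ π.Legendre)
          (r : LegendreSection π),
          IsLegendreIso G ∧ (∀ φ : OneForm n X, ContractionClosed r φ) ∧
            ∀ q, Φ q = translation r (G q)) ∧
    -- the two factors are unique
    (∀ (G G' : π.Legendre ≃ₘ⟮modelLegendre n m, modelLegendre n m⟯ π.Legendre)
      (r r' : LegendreSection π), IsLegendreIso G → IsLegendreIso G' →
        (∀ q, translation r (G q) = translation r' (G' q)) → G = G' ∧ r = r') ∧
    -- the isomorphisms normalize the translations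
    (∀ (G : π.Legendre ≃ₘ⟮modelLegendre n m, modelLegendre n m⟯ π.Legendre)
      (r : LegendreSection π), IsLegendreIso G → (∀ φ : OneForm n X, ContractionClosed r φ) →
        ∃ r' : LegendreSection π, (∀ φ : OneForm n X, ContractionClosed r' φ) ∧
          ∀ q, G (translation r q) = translation r' (G q)) ∧
    -- the closedness condition in coordinates: `∂_j r^λ_i = ∂_i r^λ_j`
    (∀ r : LegendreSection π, (∀ φ : OneForm n X, ContractionClosed r φ) ↔
      ∀ (κ : π.FibredChart), ∀ z ∈ κ.total.target, ∀ (l : Fin n) (i j : Fin m),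
        fderiv ℝ (sectionCoord r κ l i) z (0, EuclideanSpace.single j (1 : ℝ)) =
          fderiv ℝ (sectionCoord r κ l j) z (0, EuclideanSpace.single i (1 : ℝ))) := by
  refine ⟨fun Φ => ⟨fun hΦ => ?_, ?_⟩, fun G G' r r' hG hG' h =>
    translation_comp_legendreIso_unique hG hG' h, fun G r hG hr => ?_, fun r =>
    (contractionClosed_iff_hasSymmetricDerivative r).trans (hasSymmetricDerivative_iff_coord r)⟩
  · obtain ⟨G, r, hG, h⟩ := hΦ.exists_eq_translation_comp hn
    refine ⟨G, r, hG, ?_, h⟩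
    rw [contractionClosed_iff_hasSymmetricDerivative, ← isMultisymplectic_translation_iff]
    have heq : translationDiffeomorph r = G.symm.trans Φ := by
      ext1 q
      change translation r q = Φ (G.symm q)
      rw [h, G.apply_symm_apply]
    rw [heq]
    exact hG.isMultisymplectic.symm.trans hΦ
  · rintro ⟨G, r, hG, hr, h⟩
    rw [contractionClosed_iff_hasSymmetricDerivative, ← isMultisymplectic_translation_iff] at hr
    have heq : Φ = G.trans (translationDiffeomorph r) := by
      ext1 q
      exact h q
    rw [heq]
    exact hG.isMultisymplectic.trans hr
  · obtain ⟨r', hr'⟩ := hG.exists_conjugate_translation r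
    refine ⟨r', ?_, hr'⟩
    rw [contractionClosed_iff_hasSymmetricDerivative, ← isMultisymplectic_translation_iff] at hr ⊢
    have heq : translationDiffeomorph r' = (G.symm.trans (translationDiffeomorph r)).trans G := by
      ext1 q
      change translation r' q = G (translation r (G.symm q))
      rw [hr', G.apply_symm_apply]
    rw [heq]
    exact (hG.isMultisymplectic.symm.trans hr).trans hG.isMultisymplectic
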